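/- Let $n\ge 1$ be an integer and $k\ge 0$ a real number. Put $\mathbb R_+=\,]0,\infty[$, $\mu_0=k(n-1)$, $D(x)=\prod_{i=1}^n x_i$, $\omega_k(x)=\prod_{1\le i<j\le n}|x_i-x_j|^{2k}$, $$d_n(k)=\prod_{j=1}^n\frac{\Gamma(1+jk)}{\Gamma(1+k)},\qquad \Gamma_n(\mu;k)=\prod_{j=1}^n\Gamma\bigl(\mu-k(j-1)\bigr).$$ For $i=1,\dots,n$ let $$T_i(k)\varphi=\frac{\partial\varphi}{\partial x_i}+k\sum_{j\ne i}\frac{\varphi-\varphi\circ\sigma_{ij}}{x_i-x_j}$$ be the Dunkl operators of type $A_{n-1}$, where $\sigma_{ij}$ exchanges the coordinates $x_i$ and $x_j$ and the quotient is extended continuously to the hyperplane $x_i=x_j$. They act continuously on the Schwartz space $\mathcal S(\mathbb R^n)$ and, by $\langle T_i(k)u,\varphi\rangle=-\langle u,T_i(k)\varphi\rangle$, on the space $\mathcal S'(\mathbb R^n)$ of tempered distributions; put $D(T(k))=\prod_{i=1}^n T_i(k)$. For $\mu\in\mathbb C$ with $\operatorname{Re}\mu>\mu_0$ let $$\langle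 R_\mu,\varphi\rangle=\frac1{d_n(k)\Gamma_n(\mu;k)}\int_{\mathbb R_+^n}\varphi(x)\,D(x)^{\mu-\mu_0-1}\,\omega_k(x)\,dx\qquad(\varphi\in\mathcal S(\mathbb R^n)).$$ Then these integrals converge absolutely and define tempered distributions $R_\mu$, and the map $\mu\mapsto R_\mu$, $\{\operatorname{Re}\mu>\mu_0\}\to\mathcal S'(\mathbb R^n)$, extends uniquely to a holomorphic map $\mathbb C\to\mathcal S'(\mathbb R^n)$, that is, a map such that $\mu\mapsto\langle R_\mu,\varphi\rangle$ is entire for every $\varphi\in\mathcal S(\mathbb R^n)$. This extension satisfies $$D(T(k))R_\mu=R_{\mu-1}\qquad\text{for all }\mu\in\mathbb C.$$ -/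

import Mathlib

open scoped SchwartzMap LineDeriv ContDiff

namespace TypeADunkl

section Aux

theorem hasFDerivAt_integral {E F : Type} [NormedAddCommGroup E] [NormedSpace ℝ E]
    [FiniteDimensional ℝ E] [NormedAddCommGroup F] [NormedSpace ℝ F] [CompleteSpace F]
    (G : ℝ × E → F) (hG : ContDiff ℝ ∞ G) (x : E) :
    HasFDerivAt (fun y => ∫ t in (0 : ℝ)..1, G (t, y))
      (∫ t in (0 : ℝ)..1, (fderiv ℝ G (t, x)).comp (ContinuousLinearMap.inr ℝ ℝ E)) x := by
  have hcont : Continuous (fun p : ℝ × E =>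
      (fderiv ℝ G p).comp (ContinuousLinearMap.inr ℝ ℝ E)) :=
    (hG.continuous_fderiv (by simp)).clm_comp continuous_const
  have : ProperSpace E := FiniteDimensional.proper ℝ E
  obtain ⟨C, hC⟩ := ((isCompact_Icc (a := (0 : ℝ)) (b := 1)).prod
    (isCompact_closedBall x 1)).exists_bound_of_continuousOn hcont.continuousOn
  refine intervalIntegral.hasFDerivAt_integral_of_dominated_of_fderiv_le
    (F := fun y t => G (t, y))
    (F' := fun y t => (fderiv ℝ G (t, y)).comp (ContinuousLinearMap.inr ℝ ℝ E))
    (bound := fun _ => C)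
    (Metric.closedBall_mem_nhds x one_pos) ?_ ?_ ?_ ?_ ?_ ?_
  · exact Filter.Eventually.of_forall fun y =>
      (hG.continuous.comp (by fun_prop : Continuous fun t : ℝ => (t, y))).aestronglyMeasurable
  · exact (hG.continuous.comp (by fun_prop : Continuous fun t : ℝ => (t, x))).intervalIntegrable _ _
  · exact (hcont.comp (by fun_prop : Continuous fun t : ℝ => (t, x))).aestronglyMeasurable
  · refine Filter.Eventually.of_forall fun t ht y hy => hC (t, y) ⟨?_, hy⟩
    rw [Set.uIoc_of_le zero_le_one] at ht
    exact ⟨ht.1.le, ht.2⟩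
  · exact intervalIntegrable_const
  · refine Filter.Eventually.of_forall fun t ht y hy => ?_
    have h1 : HasFDerivAt G (fderiv ℝ G (t, y)) (t, y) :=
      (hG.differentiable (by simp) _).hasFDerivAt
    exact h1.comp y (hasFDerivAt_prodMk_right t y)

theorem contDiff_fderiv_inr {E F : Type} [NormedAddCommGroup E] [NormedSpace ℝ E]
    [NormedAddCommGroup F] [NormedSpace ℝ F] (G : ℝ × E → F) (hG : ContDiff ℝ ∞ G) :
    ContDiff ℝ ∞ (fun p => (fderiv ℝ G p).comp (ContinuousLinearMap.inr ℝ ℝ E)) :=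
  (hG.fderiv_right (by simp)).clm_comp contDiff_const

theorem contDiff_integral_nat {E : Type} [NormedAddCommGroup E] [NormedSpace ℝ E]
    [FiniteDimensional ℝ E] (m : ℕ) : ∀ {F : Type} [NormedAddCommGroup F] [NormedSpace ℝ F]
    [CompleteSpace F] (G : ℝ × E → F), ContDiff ℝ ∞ G →
    ContDiff ℝ m (fun y => ∫ t in (0 : ℝ)..1, G (t, y)) := by
  induction m with
  | zero =>
    intro F _ _ _ G hG
    simp only [Nat.cast_zero, contDiff_zero]
    exact continuous_iff_continuousAt.2 fun x => (hasFDerivAt_integral G hG x).continuousAt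
  | succ m ih =>
    intro F _ _ _ G hG
    have h : (((m + 1 : ℕ) : ℕ∞) : WithTop ℕ∞) = (m : WithTop ℕ∞) + 1 := by simp
    refine (contDiff_succ_iff_hasFDerivAt (n := m)).2 ⟨_, ih _ (contDiff_fderiv_inr G hG),
      fun x => hasFDerivAt_integral G hG x⟩

theorem norm_iteratedFDeriv_integral_le {E : Type} [NormedAddCommGroup E] [NormedSpace ℝ E]
    [FiniteDimensional ℝ E] (m : ℕ) : ∀ {F : Type} [NormedAddCommGroup F] [NormedSpace ℝ F]
    [CompleteSpace F] (G : ℝ × E → F), ContDiff ℝ ∞ G → ∀ (x : E) (C : ℝ),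
    (∀ t ∈ Set.Icc (0 : ℝ) 1, ‖iteratedFDeriv ℝ m (fun y => G (t, y)) x‖ ≤ C) →
    ‖iteratedFDeriv ℝ m (fun y => ∫ t in (0 : ℝ)..1, G (t, y)) x‖ ≤ C := by
  induction m with
  | zero =>
    intro F _ _ _ G hG x C h
    simp only [norm_iteratedFDeriv_zero] at h ⊢
    have := intervalIntegral.norm_integral_le_of_norm_le_const (a := (0 : ℝ)) (b := 1) (C := C)
      (f := fun t => G (t, x)) (fun t ht => by
        rw [Set.uIoc_of_le zero_le_one] at ht
        exact h t ⟨ht.1.le, ht.2⟩)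
    simpa using this
  | succ m ih =>
    intro F _ _ _ G hG x C h
    rw [← norm_iteratedFDeriv_fderiv]
    have h1 : fderiv ℝ (fun y => ∫ t in (0 : ℝ)..1, G (t, y)) = fun y =>
        ∫ t in (0 : ℝ)..1, (fderiv ℝ G (t, y)).comp (ContinuousLinearMap.inr ℝ ℝ E) :=
      funext fun y => (hasFDerivAt_integral G hG y).fderiv
    rw [h1]
    refine ih _ (contDiff_fderiv_inr G hG) x C fun t ht => ?_
    have h2 : (fun y => (fderiv ℝ G (t, y)).comp (ContinuousLinearMap.inr ℝ ℝ E)) =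
        fderiv ℝ (fun y => G (t, y)) := funext fun y => by
      have h3 : HasFDerivAt G (fderiv ℝ G (t, y)) (t, y) :=
        (hG.differentiable (by simp) _).hasFDerivAt
      exact (h3.comp y (hasFDerivAt_prodMk_right t y)).fderiv.symm
    rw [h2, norm_iteratedFDeriv_fderiv]
    exact h t ht

/-- Recovering bounds for `g` from bounds for `u • g`, where `u` is a linear form. -/
theorem abs_mul_norm_iteratedFDeriv_le {E : Type} [NormedAddCommGroup E] [NormedSpace ℝ E]
    (u : E →L[ℝ] ℝ) (m : ℕ) : ∀ {F : Type} [NormedAddCommGroup F] [NormedSpace ℝ F]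
    (g : E → F), ContDiff ℝ ∞ g → ∀ x : E,
    |u x| * ‖iteratedFDeriv ℝ m g x‖ ≤ ‖iteratedFDeriv ℝ m (fun y => u y • g y) x‖ +
      m * ‖u‖ * ‖iteratedFDeriv ℝ (m - 1) g x‖ := by
  induction m with
  | zero => intro F _ _ g hg x; simp [norm_smul]
  | succ m ih =>
    intro F _ _ g hg x
    have hg' : ContDiff ℝ ∞ (fderiv ℝ g) := hg.fderiv_right (by simp)
    have hug : ContDiff ℝ ∞ (fun y => u y • g y) := u.contDiff.smul hg
    let L : F →L[ℝ] E →L[ℝ] F := ContinuousLinearMap.smulRightL ℝ E F u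
    have hL : ‖L‖ ≤ ‖u‖ := ContinuousLinearMap.opNorm_le_bound _ (norm_nonneg _) fun z => by
      simp [L]
    have h1 : (fun y => u y • fderiv ℝ g y) =
        fderiv ℝ (fun y => u y • g y) - (L ∘ g) := funext fun y => by
      have h3 : HasFDerivAt g (fderiv ℝ g y) y := (hg.differentiable (by simp) _).hasFDerivAt
      have := (u.hasFDerivAt (x := y)).smul h3
      have h4 := this.fderiv
      simp only [Pi.sub_apply, Function.comp]
      change _ = fderiv ℝ (⇑u • g) y - _
      rw [h4]
      ext z
      simp [L]
    have h2 := ih (fderiv ℝ g) hg' x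
    rw [h1, norm_iteratedFDeriv_fderiv] at h2
    have h5 : ‖iteratedFDeriv ℝ m (fderiv ℝ (fun y => u y • g y) - (L ∘ g)) x‖ ≤
        ‖iteratedFDeriv ℝ (m + 1) (fun y => u y • g y) x‖ + ‖u‖ * ‖iteratedFDeriv ℝ m g x‖ := by
      rw [iteratedFDeriv_sub_apply
        ((hug.fderiv_right (m := ∞) (by simp)).of_le (by exact_mod_cast le_top)).contDiffAt
        ((L.contDiff.comp hg).of_le (by exact_mod_cast le_top)).contDiffAt]
      refine (norm_sub_le _ _).trans ?_
      rw [norm_iteratedFDeriv_fderiv]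
      gcongr
      refine (L.norm_iteratedFDeriv_comp_left
        (hg.of_le (by exact_mod_cast le_top) : ContDiff ℝ m g).contDiffAt le_rfl).trans ?_
      gcongr
    have h6 : (m : ℝ) * ‖u‖ * ‖iteratedFDeriv ℝ (m - 1) (fderiv ℝ g) x‖ =
        m * ‖u‖ * ‖iteratedFDeriv ℝ m g x‖ := by
      rcases m with _ | m
      · simp
      · rw [norm_iteratedFDeriv_fderiv]; rfl
    rw [h6] at h2
    rw [show m + 1 - 1 = m from rfl]
    push_cast
    linarith

/-- The differential-difference quotient attached to a linear form `u` and a vector `v`, as an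
integral mean of directional derivatives along the segment from `x` to `x - u x • v`. -/
noncomputable def meanDeriv {E : Type} [NormedAddCommGroup E] [NormedSpace ℝ E]
    (u : E →L[ℝ] ℝ) (v : E) (φ : 𝓢(E, ℂ)) (x : E) : ℂ :=
  ∫ t in (0 : ℝ)..1, (∂_{v} φ) (x - (t * u x) • v)

variable {E : Type} [NormedAddCommGroup E] [NormedSpace ℝ E]

theorem contDiff_segment (u : E →L[ℝ] ℝ) (v : E) (ψ : 𝓢(E, ℂ)) :
    ContDiff ℝ ∞ (fun p : ℝ × E => ψ (p.2 - (p.1 * u p.2) • v)) :=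
  (ψ.smooth ⊤).comp (by fun_prop)

theorem contDiff_meanDeriv [FiniteDimensional ℝ E] (u : E →L[ℝ] ℝ) (v : E) (φ : 𝓢(E, ℂ)) :
    ContDiff ℝ ∞ (meanDeriv u v φ) :=
  contDiff_infty.2 fun m => contDiff_integral_nat m _ (contDiff_segment u v (∂_{v} φ))

theorem mul_meanDeriv (u : E →L[ℝ] ℝ) (v : E) (φ : 𝓢(E, ℂ)) (x : E) :
    u x • meanDeriv u v φ x = φ x - φ (x - u x • v) := by
  have hd : ∀ t ∈ Set.uIcc (0 : ℝ) 1, HasDerivAt (fun t : ℝ => -φ (x - (t * u x) • v))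
      (u x • (∂_{v} φ) (x - (t * u x) • v)) t := by
    intro t _
    have h1 : HasDerivAt (fun t : ℝ => x - (t * u x) • v) (-(u x • v)) t := by
      have h0 := (((hasDerivAt_id t).mul_const (u x)).smul_const v).const_sub x
      simpa using h0
    have h2 := ((φ.hasFDerivAt (x - (t * u x) • v)).comp_hasDerivAt t h1).neg
    rw [SchwartzMap.lineDerivOp_apply_eq_fderiv]
    have h3 : (fun t : ℝ => -φ (x - (t * u x) • v)) = -⇑φ ∘ fun t => x - (t * u x) • v := rfl
    rw [h3]
    simpa using h2
  have hc : Continuous (fun t : ℝ => u x • (∂_{v} φ) (x - (t * u x) • v)) :=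
    Continuous.const_smul (g := fun t : ℝ => (∂_{v} φ) (x - (t * u x) • v))
      ((∂_{v} φ).continuous.comp (by fun_prop)) (u x)
  have := intervalIntegral.integral_eq_sub_of_hasDerivAt hd (hc.intervalIntegrable _ _)
  rw [intervalIntegral.integral_smul] at this
  rw [meanDeriv, this]
  simp
  ring

theorem norm_pow_mul_meanDeriv_le [FiniteDimensional ℝ E] (u : E →L[ℝ] ℝ) (v : E)
    (φ : 𝓢(E, ℂ)) (k m : ℕ) (x : E) (hx : |u x| ≤ 1) :
    ‖x‖ ^ k * ‖iteratedFDeriv ℝ m (meanDeriv u v φ) x‖ ≤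
      2 ^ k * (1 + ‖u‖ * ‖v‖) ^ m * (SchwartzMap.seminorm ℂ k m (∂_{v} φ) +
        ‖v‖ ^ k * SchwartzMap.seminorm ℂ 0 m (∂_{v} φ)) := by
  set ψ := ∂_{v} φ with hψ
  set B := 2 ^ k * (1 + ‖u‖ * ‖v‖) ^ m * (SchwartzMap.seminorm ℂ k m ψ +
        ‖v‖ ^ k * SchwartzMap.seminorm ℂ 0 m ψ)
  have hB : 0 ≤ B := by positivity
  have key : ∀ t ∈ Set.Icc (0 : ℝ) 1,
      ‖x‖ ^ k * ‖iteratedFDeriv ℝ m (fun y => ψ (y - (t * u y) • v)) x‖ ≤ B := by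
    intro t ht
    let A : E →L[ℝ] E := ContinuousLinearMap.id ℝ E - t • u.smulRight v
    have hA : ∀ y, A y = y - (t * u y) • v := fun y => by simp [A, smul_smul]
    have hAn : ‖A‖ ≤ 1 + ‖u‖ * ‖v‖ := by
      refine (norm_sub_le _ _).trans (add_le_add ContinuousLinearMap.norm_id_le ?_)
      rw [norm_smul, ContinuousLinearMap.norm_smulRight_apply, Real.norm_eq_abs, abs_of_nonneg ht.1]
      exact mul_le_of_le_one_left (by positivity) ht.2
    have h1 : (fun y => ψ (y - (t * u y) • v)) = ψ ∘ A := funext fun y => by simp [hA]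
    have h2 : ‖iteratedFDeriv ℝ m (ψ ∘ A) x‖ ≤
        (1 + ‖u‖ * ‖v‖) ^ m * ‖iteratedFDeriv ℝ m ψ (A x)‖ := by
      rw [A.iteratedFDeriv_comp_right (ψ.smooth ⊤) x (by exact_mod_cast le_top)]
      refine (ContinuousMultilinearMap.norm_compContinuousLinearMap_le _ _).trans ?_
      rw [Finset.prod_const, Finset.card_univ, Fintype.card_fin, mul_comm]
      gcongr
    have h3 : ‖x‖ ≤ ‖A x‖ + ‖v‖ := by
      have : x = A x + (t * u x) • v := by rw [hA]; simp
      calc ‖x‖ = ‖A x + (t * u x) • v‖ := by rw [← this]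
        _ ≤ ‖A x‖ + ‖(t * u x) • v‖ := norm_add_le _ _
        _ ≤ ‖A x‖ + ‖v‖ := by
          gcongr
          rw [norm_smul, Real.norm_eq_abs, abs_mul, abs_of_nonneg ht.1]
          exact mul_le_of_le_one_left (norm_nonneg _) (mul_le_one₀ ht.2 (abs_nonneg _) hx)
    have h4 : ‖x‖ ^ k ≤ 2 ^ k * (‖A x‖ ^ k + ‖v‖ ^ k) := by
      refine (pow_le_pow_left₀ (norm_nonneg _) h3 k).trans
        ((add_pow_le (norm_nonneg _) (norm_nonneg _) k).trans ?_)
      gcongr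
      · norm_num
      · exact Nat.sub_le _ _
    have h5 := ψ.le_seminorm ℂ k m (A x)
    have h6 := ψ.le_seminorm ℂ 0 m (A x)
    rw [pow_zero, one_mul] at h6
    rw [h1]
    calc ‖x‖ ^ k * ‖iteratedFDeriv ℝ m (ψ ∘ A) x‖
        ≤ (2 ^ k * (‖A x‖ ^ k + ‖v‖ ^ k)) *
          ((1 + ‖u‖ * ‖v‖) ^ m * ‖iteratedFDeriv ℝ m ψ (A x)‖) := by gcongr
      _ = 2 ^ k * (1 + ‖u‖ * ‖v‖) ^ m * (‖A x‖ ^ k * ‖iteratedFDeriv ℝ m ψ (A x)‖ +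
          ‖v‖ ^ k * ‖iteratedFDeriv ℝ m ψ (A x)‖) := by ring
      _ ≤ B := by simp only [B]; gcongr
  rcases (pow_nonneg (norm_nonneg x) k).eq_or_lt with h0 | h0
  · rw [← h0, zero_mul]; exact hB
  · rw [mul_comm, ← le_div_iff₀ h0]
    refine norm_iteratedFDeriv_integral_le m _ (contDiff_segment u v ψ) x _ fun t ht => ?_
    rw [le_div_iff₀ h0, mul_comm]
    exact key t ht

theorem exists_seminorm_meanDeriv [FiniteDimensional ℝ E] (u : E →L[ℝ] ℝ) (v : E)
    (H : 𝓢(E, ℂ) →L[ℂ] 𝓢(E, ℂ)) (hH : ∀ φ x, H φ x = φ x - φ (x - u x • v)) (m : ℕ) :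
    ∀ k : ℕ, ∃ q : Seminorm ℂ 𝓢(E, ℂ), Continuous q ∧ ∀ φ x,
      ‖x‖ ^ k * ‖iteratedFDeriv ℝ m (meanDeriv u v φ) x‖ ≤ q φ := by
  have hp : ∀ k m : ℕ, Continuous (SchwartzMap.seminorm ℂ k m : Seminorm ℂ 𝓢(E, ℂ)) :=
    fun k m => (schwartz_withSeminorms ℂ E ℂ).continuous_seminorm (k, m)
  let D : 𝓢(E, ℂ) →L[ℂ] 𝓢(E, ℂ) := LineDeriv.lineDerivOpCLM ℂ 𝓢(E, ℂ) v
  have hD : ∀ φ, ∂_{v} φ = D φ := fun φ => rfl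
  -- the part near the hyperplane `u = 0`, and the part away from it given order `m - 1`
  have main : ∀ m k : ℕ, ∀ r : Seminorm ℂ 𝓢(E, ℂ), Continuous r →
      (∀ φ x, ‖x‖ ^ k * (m * ‖u‖ * ‖iteratedFDeriv ℝ (m - 1) (meanDeriv u v φ) x‖) ≤ r φ) →
      ∃ q : Seminorm ℂ 𝓢(E, ℂ), Continuous q ∧ ∀ φ x,
        ‖x‖ ^ k * ‖iteratedFDeriv ℝ m (meanDeriv u v φ) x‖ ≤ q φ := by
    intro m k r hr hrb
    let c : NNReal := 2 ^ k * (1 + ‖u‖₊ * ‖v‖₊) ^ m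
    let d : NNReal := c * ‖v‖₊ ^ k
    let q1 : Seminorm ℂ 𝓢(E, ℂ) := (SchwartzMap.seminorm ℂ k m).comp D.toLinearMap
    let q2 : Seminorm ℂ 𝓢(E, ℂ) := (SchwartzMap.seminorm ℂ 0 m).comp D.toLinearMap
    let q3 : Seminorm ℂ 𝓢(E, ℂ) := (SchwartzMap.seminorm ℂ k m).comp H.toLinearMap
    refine ⟨c • q1 + d • q2 + (q3 + r), ?_, fun φ x => ?_⟩
    · have e1 : Continuous q1 := (hp k m).comp D.continuous
      have e2 : Continuous q2 := (hp 0 m).comp D.continuous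
      have e3 : Continuous q3 := (hp k m).comp H.continuous
      have : (⇑(c • q1 + d • q2 + (q3 + r)) : 𝓢(E, ℂ) → ℝ) =
          fun φ => (c : ℝ) * q1 φ + d * q2 φ + (q3 φ + r φ) := rfl
      rw [this]
      fun_prop
    · change _ ≤ (c : ℝ) * q1 φ + d * q2 φ + (q3 φ + r φ)
      have n1 : 0 ≤ q1 φ := apply_nonneg q1 φ
      have n2 : 0 ≤ q2 φ := apply_nonneg q2 φ
      have n3 : 0 ≤ q3 φ := apply_nonneg q3 φ
      have n4 : 0 ≤ r φ := apply_nonneg r φ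
      rcases le_total |u x| 1 with hx | hx
      · have h1 := norm_pow_mul_meanDeriv_le u v φ k m x hx
        have h2 : 2 ^ k * (1 + ‖u‖ * ‖v‖) ^ m * (SchwartzMap.seminorm ℂ k m (∂_{v} φ) +
            ‖v‖ ^ k * SchwartzMap.seminorm ℂ 0 m (∂_{v} φ)) = (c : ℝ) * q1 φ + d * q2 φ := by
          change 2 ^ k * (1 + ‖u‖ * ‖v‖) ^ m * (q1 φ + ‖v‖ ^ k * q2 φ) = _
          simp only [c, d]
          push_cast
          ring
        linarith
      · have h1 := abs_mul_norm_iteratedFDeriv_le u m _ (contDiff_meanDeriv u v φ) x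
        have h2 : (fun y => u y • meanDeriv u v φ y) = H φ :=
          funext fun y => by rw [mul_meanDeriv, hH]
        rw [h2] at h1
        have h3 := (H φ).le_seminorm ℂ k m x
        have h4 : ‖iteratedFDeriv ℝ m (meanDeriv u v φ) x‖ ≤
            |u x| * ‖iteratedFDeriv ℝ m (meanDeriv u v φ) x‖ :=
          le_mul_of_one_le_left (norm_nonneg _) hx
        have h5 := mul_le_mul_of_nonneg_left (h4.trans h1) (pow_nonneg (norm_nonneg x) k)
        rw [mul_add] at h5
        have h6 := hrb φ x
        change _ ≤ q3 φ at h3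
        have : 0 ≤ (c : ℝ) * q1 φ + d * q2 φ := by positivity
        linarith
  induction m with
  | zero => exact fun k => main 0 k 0 (by exact continuous_const) (fun φ x => by simp)
  | succ m ih =>
    intro k
    obtain ⟨q, hq, hb⟩ := ih k
    refine main (m + 1) k (((m + 1 : NNReal) * ‖u‖₊) • q) ?_ fun φ x => ?_
    · have : (⇑(((m + 1 : NNReal) * ‖u‖₊) • q) : 𝓢(E, ℂ) → ℝ) =
          fun φ => (((m + 1 : NNReal) * ‖u‖₊ : NNReal) : ℝ) * q φ := rfl
      rw [this]
      fun_prop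
    · change _ ≤ (((m + 1 : NNReal) * ‖u‖₊ : NNReal) : ℝ) * q φ
      have := mul_le_mul_of_nonneg_left (hb φ x) (by positivity : 0 ≤ ((m : ℝ) + 1) * ‖u‖)
      rw [show m + 1 - 1 = m from rfl]
      push_cast
      linarith

end Aux

/-- Exchanging the coordinates `x i` and `x j`, as a linear isometry of `ℝⁿ`. -/
noncomputable def swapCoord {n : ℕ} (i j : Fin n) :
    EuclideanSpace ℝ (Fin n) ≃L[ℝ] EuclideanSpace ℝ (Fin n) :=
  (LinearIsometryEquiv.piLpCongrLeft 2 ℝ ℝ (Equiv.swap i j)).toContinuousLinearEquiv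

/-- The quotient `(φ(x) - φ(σᵢⱼ x)) / (xᵢ - xⱼ)`, extended to the hyperplane `xᵢ = xⱼ` by its
limit there, the derivative of `φ` in the direction `eᵢ - eⱼ`. -/
noncomputable def divDiff {n : ℕ} (i j : Fin n) (φ : 𝓢(EuclideanSpace ℝ (Fin n), ℂ))
    (x : EuclideanSpace ℝ (Fin n)) : ℂ :=
  if x i = x j then
    fderiv ℝ φ x (EuclideanSpace.single i 1 - EuclideanSpace.single j 1)
  else (φ x - φ (swapCoord i j x)) / ((x i - x j : ℝ) : ℂ)

theorem swapCoord_eq {n : ℕ} (i j : Fin n) (x : EuclideanSpace ℝ (Fin n)) :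
    swapCoord i j x =
      x - (x i - x j) • (EuclideanSpace.single i 1 - EuclideanSpace.single j 1) := by
  ext l
  have : (swapCoord i j x) l = x (Equiv.swap i j l) := by
    simp [swapCoord, LinearIsometryEquiv.piLpCongrLeft_apply, Equiv.piCongrLeft'_apply]
  rw [this]
  simp only [PiLp.sub_apply, PiLp.smul_apply, smul_eq_mul, PiLp.single_apply]
  by_cases hi : l = i
  · subst hi
    by_cases hj : l = j
    · subst hj; simp
    · simp [hj]
  · by_cases hj : l = j
    · subst hj; simp [hi]
    · rw [Equiv.swap_apply_of_ne_of_ne hi hj]; simp [hi, hj]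

theorem divDiff_eq_meanDeriv {n : ℕ} (i j : Fin n) (φ : 𝓢(EuclideanSpace ℝ (Fin n), ℂ)) :
    divDiff i j φ = meanDeriv
      (EuclideanSpace.proj i - EuclideanSpace.proj j : EuclideanSpace ℝ (Fin n) →L[ℝ] ℝ)
      (EuclideanSpace.single i 1 - EuclideanSpace.single j 1) φ := by
  funext x
  have h := mul_meanDeriv
    (EuclideanSpace.proj i - EuclideanSpace.proj j : EuclideanSpace ℝ (Fin n) →L[ℝ] ℝ)
    (EuclideanSpace.single i 1 - EuclideanSpace.single j 1) φ x
  have hu : (EuclideanSpace.proj i - EuclideanSpace.proj j : EuclideanSpace ℝ (Fin n) →L[ℝ] ℝ) x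
    = x i - x j := rfl
  rw [hu, ← swapCoord_eq] at h
  unfold divDiff
  split_ifs with hx
  · rw [meanDeriv, hu, hx]
    simp [SchwartzMap.lineDerivOp_apply_eq_fderiv]
  · rw [← h, Complex.real_smul, mul_div_cancel_left₀]
    exact_mod_cast sub_ne_zero.2 hx

/-- `φ ↦ (1 - σᵢⱼ) φ / (xᵢ - xⱼ)` as a continuous operator on the Schwartz space. -/
noncomputable def divDiffCLM {n : ℕ} (i j : Fin n) :
    𝓢(EuclideanSpace ℝ (Fin n), ℂ) →L[ℂ] 𝓢(EuclideanSpace ℝ (Fin n), ℂ) :=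
  SchwartzMap.mkCLM (σ := RingHom.id ℂ) (divDiff i j)
    (fun φ ψ x => by
      unfold divDiff
      split_ifs with hx
      · have : (⇑(φ + ψ) : EuclideanSpace ℝ (Fin n) → ℂ) = ⇑φ + ⇑ψ := rfl
        rw [this, fderiv_add φ.differentiableAt ψ.differentiableAt]
        rfl
      · simp only [add_apply]
        ring)
    (fun a φ x => by
      unfold divDiff
      split_ifs with hx
      · have : (⇑(a • φ) : EuclideanSpace ℝ (Fin n) → ℂ) = a • ⇑φ := rfl
        rw [this, fderiv_const_smul φ.differentiableAt]
        rfl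
      · simp only [smul_apply, smul_eq_mul, RingHom.id_apply]
        ring)
    (fun φ => by rw [divDiff_eq_meanDeriv]; exact contDiff_meanDeriv _ _ φ)
    (fun p => by
      obtain ⟨q, hq, hb⟩ := exists_seminorm_meanDeriv
        (EuclideanSpace.proj i - EuclideanSpace.proj j : EuclideanSpace ℝ (Fin n) →L[ℝ] ℝ)
        (EuclideanSpace.single i 1 - EuclideanSpace.single j 1)
        (ContinuousLinearMap.id ℂ _ -
          SchwartzMap.compCLMOfContinuousLinearEquiv ℂ (swapCoord i j))
        (fun φ x => by
          change φ x - φ (swapCoord i j x) = _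
          rw [swapCoord_eq]; rfl) p.2 p.1
      obtain ⟨s, C, -, hC⟩ := Seminorm.bound_of_continuous
        (schwartz_withSeminorms ℂ (EuclideanSpace ℝ (Fin n)) ℂ) q hq
      refine ⟨s, C, C.coe_nonneg, fun φ x => ?_⟩
      rw [divDiff_eq_meanDeriv]
      exact (hb φ x).trans (hC φ))

/-- The Dunkl operator `Tᵢ(k) = ∂ᵢ + k ∑_{j ≠ i} (1 - σᵢⱼ) / (xᵢ - xⱼ)` of type `A`, as a continuous
operator on the Schwartz space. -/
noncomputable def dunklOp {n : ℕ} (k : ℝ) (i : Fin n) :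
    𝓢(EuclideanSpace ℝ (Fin n), ℂ) →L[ℂ] 𝓢(EuclideanSpace ℝ (Fin n), ℂ) :=
  LineDeriv.lineDerivOpCLM ℂ 𝓢(EuclideanSpace ℝ (Fin n), ℂ) (EuclideanSpace.single i (1 : ℝ)) +
    (k : ℂ) • ∑ j ∈ Finset.univ.erase i, divDiffCLM i j

/-- The Dunkl operator on tempered distributions: `⟨Tᵢ(k) u, φ⟩ = -⟨u, Tᵢ(k) φ⟩`. -/
noncomputable def dunklDist {n : ℕ} (k : ℝ) (i : Fin n) :
    𝓢'(EuclideanSpace ℝ (Fin n), ℂ) →L[ℂ] 𝓢'(EuclideanSpace ℝ (Fin n), ℂ) :=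
  PointwiseConvergenceCLM.precomp ℂ (-dunklOp k i)

/-- The product `D(T(k)) = T₁(k) T₂(k) ⋯ Tₙ(k)` acting on tempered distributions. The Dunkl
operators commute, so that the order of the factors plays no role. -/
noncomputable def dunklProdDist (n : ℕ) (k : ℝ) :
    𝓢'(EuclideanSpace ℝ (Fin n), ℂ) →L[ℂ] 𝓢'(EuclideanSpace ℝ (Fin n), ℂ) :=
  (List.ofFn fun i : Fin n => dunklDist k i).prod

/-- The open positive orthant `ℝ₊ⁿ`. -/
def posOrthant (n : ℕ) : Set (EuclideanSpace ℝ (Fin n)) := {x | ∀ i, 0 < x i}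

/-- The weight `ω_k(x) = ∏_{i < j} |xᵢ - xⱼ|^{2k}`. -/
noncomputable def weight {n : ℕ} (k : ℝ) (x : EuclideanSpace ℝ (Fin n)) : ℝ :=
  ∏ i : Fin n, ∏ j ∈ Finset.Ioi i, |x i - x j| ^ (2 * k)

/-- `μ₀ = k (n - 1)`. -/
def muZero (n : ℕ) (k : ℝ) : ℝ := k * ((n : ℝ) - 1)

/-- `d_n(k) = ∏_{j=1}^n Γ(1 + jk) / Γ(1 + k)`. -/
noncomputable def dConst (n : ℕ) (k : ℝ) : ℝ :=
  ∏ j ∈ Finset.Icc 1 n, Real.Gamma (1 + j * k) / Real.Gamma (1 + k)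

/-- `Γ_n(μ; k) = ∏_{j=1}^n Γ(μ - k (j - 1))`. -/
noncomputable def multiGamma (n : ℕ) (k : ℝ) (μ : ℂ) : ℂ :=
  ∏ j ∈ Finset.Icc 1 n, Complex.Gamma (μ - k * ((j : ℂ) - 1))

/-- The density
`(d_n(k) Γ_n(μ; k))⁻¹ D(x)^{μ - μ₀ - 1} ω_k(x)` on `ℝ₊ⁿ`, where `D(x) = x₁ ⋯ xₙ`. -/
noncomputable def rieszDensity {n : ℕ} (k : ℝ) (μ : ℂ) (x : EuclideanSpace ℝ (Fin n)) : ℂ :=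
  1 / (dConst n k * multiGamma n k μ) *
    ((∏ i, x i : ℝ) : ℂ) ^ (μ - muZero n k - 1) * (weight k x : ℂ)

/-- The tempered distribution `u` is the Riesz measure with index `μ`: for every Schwartz function
`φ` the integral of `φ` against the Riesz density over `ℝ₊ⁿ` converges absolutely, and equals
`⟨u, φ⟩`. -/
def IsRieszMeasure {n : ℕ} (k : ℝ) (μ : ℂ) (u : 𝓢'(EuclideanSpace ℝ (Fin n), ℂ)) : Prop :=
  ∀ φ : 𝓢(EuclideanSpace ℝ (Fin n), ℂ),
    MeasureTheory.IntegrableOn (fun x => φ x * rieszDensity k μ x) (posOrthant n) ∧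
      u φ = ∫ x in posOrthant n, φ x * rieszDensity k μ x

/-- Holomorphy on `ℂ` of a map with values in the tempered distributions: `μ ↦ ⟨R_μ, φ⟩` is entire
for every Schwartz function `φ`. -/
def IsEntireDist {n : ℕ} (R : ℂ → 𝓢'(EuclideanSpace ℝ (Fin n), ℂ)) : Prop :=
  ∀ φ : 𝓢(EuclideanSpace ℝ (Fin n), ℂ), Differentiable ℂ fun μ => R μ φ

/-- `R` is a holomorphic extension to `ℂ` of the map `μ ↦ R_μ` on `{Re μ > μ₀}`. -/
def IsRieszExtension (n : ℕ) (k : ℝ) (R : ℂ → 𝓢'(EuclideanSpace ℝ (Fin n), ℂ)) : Prop :=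
  IsEntireDist R ∧ ∀ μ : ℂ, muZero n k < μ.re → IsRieszMeasure k μ (R μ)

end TypeADunkl

namespace TypeADunkl

open MeasureTheory Filter Topology

/-! The heart is a Bernstein identity: on the distributions $D(x)_+^s\omega_k$ the operator
$D(T(k))$ lowers $s$ to $s-1$ and multiplies by $\prod_{i=0}^{n-1}(s+ki)$. With $s=\mu-\mu_0-1$ this
product is exactly the quotient $\Gamma_n(\mu;k)/\Gamma_n(\mu-1;k)$, so the normalised $R_\mu$ goes
to $R_{\mu-1}$.

The operators $T_i(k)$ are applied one at a time to $\prod_l x_{l+}^{a_l}\,\omega_k$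
(`pairing_dunkl_eq`). Integration by parts produces $a_i$ times the product with $a_i$ lowered by
one, together with $2k\,\omega_k/(x_i-x_j)$ from the weight. Antisymmetrising in $x_i,x_j$ splits
the singular term in two: one part cancels the difference part of $T_i(k)$, the other is the divided
difference of the product of powers. The latter is $0$ if $a_j=a_i$, and if $a_j=a_i-1$ it is again
the product with $a_i$ lowered. Letting $T_n,\dots,T_1$ act in this order keeps every exponent in
one of these two cases (`dunklProdDist_prodPowDist`).

For small $k$ the singular term need not be integrable, so the weight is first regularised by
$\varepsilon>0$; after antisymmetrisation everything is dominated uniformly and $\varepsilon\to0$ is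
harmless.

Finally $D(T(k))^mR_{\mu+m}$ does not depend on $m$ once $\operatorname{Re}\mu+m>\mu_0$, and defines
the extension. Holomorphy, uniqueness and the recursion follow from differentiation under the
integral and the identity theorem. -/

/-! ### Truncated powers in one variable -/

/-- The function `t₊ᵃ`: the power `tᵃ` for `t > 0`, extended by zero. -/
noncomputable def posPow (a : ℂ) (t : ℝ) : ℂ := if 0 < t then (t : ℂ) ^ a else 0

theorem norm_posPow (a : ℂ) (t : ℝ) : ‖posPow a t‖ = if 0 < t then t ^ a.re else 0 := by
  unfold posPow
  split_ifs with h
  · exact Complex.norm_cpow_eq_rpow_re_of_pos h a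
  · exact norm_zero

theorem measurable_posPow (a : ℂ) : Measurable (posPow a) :=
  Measurable.ite measurableSet_Ioi (Complex.measurable_ofReal.pow_const a) measurable_const

theorem mul_posPow (a : ℂ) (t : ℝ) : (t : ℂ) * posPow a t = posPow (a + 1) t := by
  unfold posPow
  split_ifs with h
  · rw [Complex.cpow_add _ _ (by exact_mod_cast h.ne'), Complex.cpow_one, mul_comm]
  · exact mul_zero _

theorem tendsto_posPow_zero {a : ℂ} (ha : 0 < a.re) : Tendsto (posPow a) (𝓝 0) (𝓝 0) := by
  refine squeeze_zero_norm (a := fun t : ℝ => |t| ^ a.re) (fun t => ?_) ?_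
  · rw [norm_posPow]
    split_ifs with h
    · rw [abs_of_pos h]
    · positivity
  · have : Continuous fun t : ℝ => |t| ^ a.re := continuous_abs.rpow_const fun _ => Or.inr ha.le
    simpa [Real.zero_rpow ha.ne'] using this.tendsto 0

/-- At the origin the slope is $t_+^{a-1}$, which tends to $0$ because $\operatorname{Re}a>1$.
Differentiability on the whole line is what spares all boundary terms in the integration by parts.
-/
theorem hasDerivAt_posPow {a : ℂ} (ha : 1 < a.re) (t : ℝ) :
    HasDerivAt (posPow a) (a * posPow (a - 1) t) t := by
  rcases lt_trichotomy t 0 with h | rfl | h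
  · have : posPow a =ᶠ[𝓝 t] fun _ => 0 := by
      filter_upwards [Iio_mem_nhds h] with y hy
      exact if_neg (not_lt.2 (le_of_lt hy))
    simpa [posPow, not_lt.2 h.le] using (hasDerivAt_const t (0 : ℂ)).congr_of_eventuallyEq this
  · rw [hasDerivAt_iff_tendsto_slope_zero]
    have h1 : Tendsto (posPow (a - 1)) (𝓝[≠] 0) (𝓝 0) :=
      (tendsto_posPow_zero (by simpa using ha)).mono_left nhdsWithin_le_nhds
    have h0 : posPow a 0 = 0 := by simp [posPow]
    have h2 : posPow (a - 1) 0 = 0 := by simp [posPow]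
    rw [h2, mul_zero]
    refine h1.congr' ?_
    filter_upwards [self_mem_nhdsWithin] with t ht
    have := mul_posPow (a - 1) t
    rw [sub_add_cancel] at this
    rw [zero_add, h0, sub_zero, ← this, Complex.real_smul, ← mul_assoc, ← Complex.ofReal_mul,
      inv_mul_cancel₀ ht, Complex.ofReal_one, one_mul]
  · have h1 : posPow a =ᶠ[𝓝 t] fun y => (y : ℂ) ^ a := by
      filter_upwards [Ioi_mem_nhds h] with y hy
      exact if_pos hy
    have h2 := (hasDerivAt_ofReal_cpow_const (x := t) h.ne' (r := a)
      (fun h => by rw [h] at ha; simp at ha; linarith)).congr_of_eventuallyEq h1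
    simpa [posPow, h] using h2

/-- The first hypothesis gives integrability near $0$, the second at infinity; hence the cuts at $0$
and $1$. -/
theorem integrable_norm_posPow_mul {a : ℂ} (ha : -1 < a.re) {K : ℕ} (hK : a.re + 1 < K) :
    Integrable fun t : ℝ => ‖posPow a t‖ * ((1 + |t|) ^ K)⁻¹ := by
  have hm : Measurable fun t : ℝ => ‖posPow a t‖ * ((1 + |t|) ^ K)⁻¹ :=
    (measurable_posPow a).norm.mul (by fun_prop)
  have h1 : IntegrableOn (fun t : ℝ => ‖posPow a t‖ * ((1 + |t|) ^ K)⁻¹) (Set.Ioc 0 1) := by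
    have := (intervalIntegral.intervalIntegrable_rpow' (a := 0) (b := 1) ha).1
    refine this.mono' hm.aestronglyMeasurable ?_
    filter_upwards [ae_restrict_mem measurableSet_Ioc] with t ht
    rw [Real.norm_of_nonneg (by positivity), norm_posPow, if_pos ht.1]
    refine mul_le_of_le_one_right (Real.rpow_nonneg ht.1.le _) (inv_le_one_of_one_le₀ ?_)
    exact one_le_pow₀ (by linarith [abs_nonneg t])
  have h2 : IntegrableOn (fun t : ℝ => ‖posPow a t‖ * ((1 + |t|) ^ K)⁻¹) (Set.Ioi 1) := by
    have := integrableOn_Ioi_rpow_of_lt (a := a.re - K) (by linarith) one_pos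
    refine this.mono' hm.aestronglyMeasurable ?_
    filter_upwards [ae_restrict_mem measurableSet_Ioi] with t ht
    have ht' : 0 < t := one_pos.trans ht
    rw [Real.norm_of_nonneg (by positivity), norm_posPow, if_pos ht', Real.rpow_sub ht',
      Real.rpow_natCast, div_eq_mul_inv]
    gcongr
    rw [abs_of_pos ht']; linarith
  have h3 : IntegrableOn (fun t : ℝ => ‖posPow a t‖ * ((1 + |t|) ^ K)⁻¹) (Set.Iic 0) := by
    refine (integrableOn_zero).congr_fun (fun t ht => ?_) measurableSet_Iic
    rw [norm_posPow, if_neg (not_lt.2 ht), zero_mul]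
  rw [← integrableOn_univ]
  have hu : (Set.univ : Set ℝ) = Set.Iic 0 ∪ (Set.Ioc 0 1 ∪ Set.Ioi 1) := by
    rw [Set.Ioc_union_Ioi_eq_Ioi zero_le_one, Set.Iic_union_Ioi]
  rw [hu]
  exact h3.union (h1.union h2)

/-! ### Products of powers against Schwartz functions -/

variable {n : ℕ}

/-- The function `∏ xₗ₊^{aₗ}` on `ℝⁿ`. -/
noncomputable def prodPow (a : Fin n → ℂ) (x : EuclideanSpace ℝ (Fin n)) : ℂ :=
  ∏ l, posPow (a l) (x l)

theorem measurable_prodPow (a : Fin n → ℂ) : Measurable (prodPow a) :=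
  Finset.measurable_prod _ fun l _ => (measurable_posPow (a l)).comp (by fun_prop)

/-- `B` is independent of `φ`, which enters through a seminorm only. The same estimate therefore
yields integrability, the limit $\varepsilon\to0$ and continuity in `φ`; the power `M` is room for a
weight of polynomial growth. -/
theorem exists_integrable_bound (a : Fin n → ℂ) (ha : ∀ l, -1 < (a l).re) (M : ℕ) :
    ∃ (N : ℕ) (B : EuclideanSpace ℝ (Fin n) → ℝ), Integrable B ∧
      ∀ (φ : 𝓢(EuclideanSpace ℝ (Fin n), ℂ)) (x : EuclideanSpace ℝ (Fin n)),
        ‖φ x‖ * ‖prodPow a x‖ * (1 + ‖x‖) ^ M ≤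
          2 ^ N * (Finset.Iic (N, 0)).sup (schwartzSeminormFamily ℂ _ ℂ) φ * B x := by
  obtain ⟨K, hK⟩ : ∃ K : ℕ, ∀ l, (a l).re + 1 < K := by
    obtain ⟨K, hK⟩ := exists_nat_gt (∑ l, |(a l).re + 1|)
    refine ⟨K, fun l => lt_of_le_of_lt ?_ hK⟩
    exact (le_abs_self _).trans (Finset.single_le_sum (f := fun l => |(a l).re + 1|)
      (fun _ _ => abs_nonneg _) (Finset.mem_univ l))
  let b : Fin n → ℝ → ℝ := fun l t => ‖posPow (a l) t‖ * ((1 + |t|) ^ K)⁻¹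
  -- The decay of `φ` pays `M` powers for the weight and `K` powers for each of the `n` coordinates,
  -- as $1+|x_l|\le1+\|x\|$.
  refine ⟨M + K * n, fun x => ∏ l, b l (x l), ?_, fun φ x => ?_⟩
  · have h1 : Integrable (fun y : Fin n → ℝ => ∏ l, b l (y l)) :=
      Integrable.fintype_prod fun l => integrable_norm_posPow_mul (ha l) (hK l)
    exact ((EuclideanSpace.volume_preserving_symm_measurableEquiv_toLp (Fin n)).integrable_comp_emb
      (MeasurableEquiv.measurableEmbedding _)).2 h1
  · have h1 := SchwartzMap.one_add_le_sup_seminorm_apply (𝕜 := ℂ) (m := (M + K * n, 0))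
      (k := M + K * n) (n := 0) le_rfl le_rfl φ x
    rw [norm_iteratedFDeriv_zero] at h1
    have h2 : ∏ l, (1 + |x l|) ^ K ≤ (1 + ‖x‖) ^ (K * n) := by
      calc ∏ l, (1 + |x l|) ^ K ≤ ∏ _l : Fin n, (1 + ‖x‖) ^ K := by
            refine Finset.prod_le_prod (fun _ _ => by positivity) fun l _ => ?_
            gcongr
            exact PiLp.norm_apply_le x l
        _ = _ := by simp [pow_mul]
    have h3 : ‖prodPow a x‖ = (∏ l, b l (x l)) * ∏ l, (1 + |x l|) ^ K := by
      rw [prodPow, norm_prod, ← Finset.prod_mul_distrib]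
      refine Finset.prod_congr rfl fun l _ => ?_
      have : (1 + |x l|) ^ K ≠ 0 := by positivity
      simp only [b]
      field_simp
    have h4 : 0 ≤ ∏ l, b l (x l) := Finset.prod_nonneg fun l _ => by positivity
    calc ‖φ x‖ * ‖prodPow a x‖ * (1 + ‖x‖) ^ M
        = (‖φ x‖ * (∏ l, b l (x l)) * (1 + ‖x‖) ^ M) * ∏ l, (1 + |x l|) ^ K := by rw [h3]; ring
      _ ≤ (‖φ x‖ * (∏ l, b l (x l)) * (1 + ‖x‖) ^ M) * (1 + ‖x‖) ^ (K * n) := by gcongr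
      _ = ((1 + ‖x‖) ^ (M + K * n) * ‖φ x‖) * ∏ l, b l (x l) := by ring
      _ ≤ _ := by
        exact mul_le_mul_of_nonneg_right h1 h4

theorem integrable_mul_prodPow_mul (φ : 𝓢(EuclideanSpace ℝ (Fin n), ℂ)) {a : Fin n → ℂ}
    (ha : ∀ l, -1 < (a l).re) {W : EuclideanSpace ℝ (Fin n) → ℝ} (hW : Measurable W)
    {C : ℝ} {M : ℕ} (hb : ∀ x, |W x| ≤ C * (1 + ‖x‖) ^ M) :
    Integrable fun x => φ x * prodPow a x * W x := by
  obtain ⟨N, B, hB, h⟩ := exists_integrable_bound a ha M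
  refine ((hB.const_mul (2 ^ N * (Finset.Iic (N, 0)).sup (schwartzSeminormFamily ℂ _ ℂ) φ)).const_mul
    C).mono'
    ((φ.continuous.measurable.mul (measurable_prodPow a)).mul
      hW.complex_ofReal).aestronglyMeasurable (Eventually.of_forall fun x => ?_)
  have hC : 0 ≤ C := by
    have := (abs_nonneg _).trans (hb x)
    exact nonneg_of_mul_nonneg_left this (by positivity)
  rw [norm_mul, norm_mul, Complex.norm_real, Real.norm_eq_abs]
  calc ‖φ x‖ * ‖prodPow a x‖ * |W x| ≤ ‖φ x‖ * ‖prodPow a x‖ * (C * (1 + ‖x‖) ^ M) := by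
        gcongr; exact hb x
    _ = C * (‖φ x‖ * ‖prodPow a x‖ * (1 + ‖x‖) ^ M) := by ring
    _ ≤ _ := mul_le_mul_of_nonneg_left (h φ x) hC

/-! ### The regularised weight -/

/-- The regularised weight `∏_{i ≠ j} ((xᵢ - xⱼ)² + ε)^{k/2}`. -/
noncomputable def regWeight (k ε : ℝ) (x : EuclideanSpace ℝ (Fin n)) : ℝ :=
  ∏ i, ∏ j ∈ {i}ᶜ, ((x i - x j) ^ 2 + ε) ^ (k / 2)

theorem regWeight_nonneg (k : ℝ) {ε : ℝ} (hε : 0 ≤ ε) (x : EuclideanSpace ℝ (Fin n)) :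
    0 ≤ regWeight k ε x :=
  Finset.prod_nonneg fun _ _ => Finset.prod_nonneg fun _ _ => Real.rpow_nonneg (by positivity) _

theorem continuous_regWeight {k : ℝ} (hk : 0 ≤ k) (x : EuclideanSpace ℝ (Fin n)) :
    Continuous fun ε => regWeight k ε x :=
  continuous_finsetProd _ fun i _ => continuous_finsetProd _ fun j _ =>
    Continuous.rpow_const (by fun_prop) fun _ => Or.inr (by positivity)

theorem measurable_regWeight (k ε : ℝ) :
    Measurable (regWeight k ε : EuclideanSpace ℝ (Fin n) → ℝ) :=
  Finset.measurable_prod _ fun i _ => Finset.measurable_prod _ fun j _ =>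
    Measurable.pow_const (by fun_prop) _

/-- Ordered pairs count each unordered pair twice, so the exponent $k/2$ on squares becomes $2k$ on
absolute values. -/
theorem regWeight_zero {k : ℝ} (hk : 0 ≤ k) (x : EuclideanSpace ℝ (Fin n)) :
    regWeight k 0 x = weight k x := by
  have h1 : ∀ i j, ((x i - x j) ^ 2 + 0) ^ (k / 2) = |x i - x j| ^ k := fun i j => by
    rw [add_zero, ← sq_abs, ← Real.rpow_natCast, ← Real.rpow_mul (abs_nonneg _)]
    congr 1
    push_cast
    ring
  simp only [regWeight, h1]
  rw [← Finset.prod_prod_Ioi_mul_eq_prod_prod_off_diag fun j i => |x i - x j| ^ k]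
  refine Finset.prod_congr rfl fun i _ => Finset.prod_congr rfl fun j _ => ?_
  rw [abs_sub_comm (x j), ← Real.rpow_add_of_nonneg (abs_nonneg _) hk hk, two_mul]

/-- Uniformity in `ε` is the point: this bound is the majorant when $\varepsilon\to0$. -/
theorem exists_regWeight_le {k : ℝ} (hk : 0 ≤ k) :
    ∃ (C : ℝ) (M : ℕ), ∀ ε ∈ Set.Icc (0 : ℝ) 1, ∀ x : EuclideanSpace ℝ (Fin n),
      |regWeight k ε x| ≤ C * (1 + ‖x‖) ^ M := by
  obtain ⟨p, hp⟩ := exists_nat_ge (k / 2)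
  refine ⟨∏ i : Fin n, ∏ j ∈ ({i} : Finset (Fin n))ᶜ, 4 ^ p,
    ∑ i : Fin n, ∑ j ∈ ({i} : Finset (Fin n))ᶜ, 2 * p, fun ε hε x => ?_⟩
  rw [abs_of_nonneg (regWeight_nonneg k hε.1 x), ← Finset.prod_pow_eq_pow_sum]
  simp_rw [← Finset.prod_pow_eq_pow_sum]
  rw [← Finset.prod_mul_distrib]
  simp_rw [← Finset.prod_mul_distrib]
  have h0 : ∀ i j, 0 ≤ (x i - x j) ^ 2 + ε := fun i j => add_nonneg (sq_nonneg _) hε.1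
  refine Finset.prod_le_prod (fun _ _ => Finset.prod_nonneg fun _ _ =>
    Real.rpow_nonneg (h0 _ _) _) fun i _ => Finset.prod_le_prod
    (fun _ _ => Real.rpow_nonneg (h0 _ _) _) fun j _ => ?_
  -- The right side is at least $1$, so the exponent $k/2$ may afterwards be raised to the integer
  -- `p`.
  have h1 : (x i - x j) ^ 2 + ε ≤ 4 * (1 + ‖x‖) ^ 2 := by
    have hi : |x i| ≤ ‖x‖ := PiLp.norm_apply_le x i
    have hj : |x j| ≤ ‖x‖ := PiLp.norm_apply_le x j
    have h2 : |x i - x j| ≤ 2 * ‖x‖ := (abs_sub _ _).trans (by linarith)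
    have h3 : (x i - x j) ^ 2 ≤ (2 * ‖x‖) ^ 2 := by
      rw [← sq_abs]; gcongr
    nlinarith [hε.2, norm_nonneg x]
  calc ((x i - x j) ^ 2 + ε) ^ (k / 2) ≤ (4 * (1 + ‖x‖) ^ 2) ^ (k / 2) :=
        Real.rpow_le_rpow (h0 i j) h1 (by positivity)
    _ ≤ (4 * (1 + ‖x‖) ^ 2) ^ (p : ℝ) :=
        Real.rpow_le_rpow_of_exponent_le (by nlinarith [norm_nonneg x]) hp
    _ = 4 ^ p * (1 + ‖x‖) ^ (2 * p) := by rw [Real.rpow_natCast, mul_pow, pow_mul]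

theorem exists_weight_le {k : ℝ} (hk : 0 ≤ k) :
    ∃ (C : ℝ) (M : ℕ), ∀ x : EuclideanSpace ℝ (Fin n), |weight k x| ≤ C * (1 + ‖x‖) ^ M := by
  obtain ⟨C, M, h⟩ := exists_regWeight_le (n := n) hk
  exact ⟨C, M, fun x => by rw [← regWeight_zero hk]; exact h 0 (by simp) x⟩

theorem measurable_weight {k : ℝ} (hk : 0 ≤ k) :
    Measurable (weight k : EuclideanSpace ℝ (Fin n) → ℝ) := by
  rw [show (weight k : EuclideanSpace ℝ (Fin n) → ℝ) = regWeight k 0 from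
    funext fun x => (regWeight_zero hk x).symm]
  exact measurable_regWeight k 0

/-! ### Exchange of coordinates and the weighted pairing -/

theorem swapCoord_apply (i j l : Fin n) (x : EuclideanSpace ℝ (Fin n)) :
    swapCoord i j x l = x (Equiv.swap i j l) := by
  simp [swapCoord, LinearIsometryEquiv.piLpCongrLeft_apply, Equiv.piCongrLeft'_apply]

theorem integral_comp_swapCoord (i j : Fin n) (f : EuclideanSpace ℝ (Fin n) → ℂ) :
    ∫ x, f (swapCoord i j x) = ∫ x, f x := by
  let e := LinearIsometryEquiv.piLpCongrLeft 2 ℝ ℝ (Equiv.swap i j)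
  exact e.measurePreserving.integral_comp e.toMeasurableEquiv.measurableEmbedding f

theorem prodPow_swapCoord (i j : Fin n) (a : Fin n → ℂ) (x : EuclideanSpace ℝ (Fin n)) :
    prodPow a (swapCoord i j x) = prodPow (a ∘ Equiv.swap i j) x := by
  simp only [prodPow, swapCoord_apply]
  exact Fintype.prod_equiv (Equiv.swap i j) _ _ fun l => by simp

theorem regWeight_swapCoord (k ε : ℝ) (i j : Fin n) (x : EuclideanSpace ℝ (Fin n)) :
    regWeight k ε (swapCoord i j x) = regWeight k ε x := by
  simp only [regWeight, swapCoord_apply]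
  refine Fintype.prod_equiv (Equiv.swap i j) _ _ fun l => ?_
  refine Finset.prod_equiv (Equiv.swap i j) (fun m => ?_) fun m _ => rfl
  simp

theorem mul_divDiff (i j : Fin n) (φ : 𝓢(EuclideanSpace ℝ (Fin n), ℂ))
    (x : EuclideanSpace ℝ (Fin n)) :
    ((x i - x j : ℝ) : ℂ) * divDiff i j φ x = φ x - φ (swapCoord i j x) := by
  rw [divDiff_eq_meanDeriv, swapCoord_eq, ← Complex.real_smul]
  exact mul_meanDeriv (EuclideanSpace.proj i - EuclideanSpace.proj j :
    EuclideanSpace ℝ (Fin n) →L[ℝ] ℝ) _ φ x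

theorem divDiffCLM_apply (i j : Fin n) (φ : 𝓢(EuclideanSpace ℝ (Fin n), ℂ))
    (x : EuclideanSpace ℝ (Fin n)) : divDiffCLM i j φ x = divDiff i j φ x := rfl

/-- The pairing `∫ φ ∏ xₗ₊^{aₗ} W`. -/
noncomputable def pairing (φ : 𝓢(EuclideanSpace ℝ (Fin n), ℂ)) (a : Fin n → ℂ)
    (W : EuclideanSpace ℝ (Fin n) → ℝ) : ℂ :=
  ∫ x, φ x * prodPow a x * W x

theorem pairing_comp_swapCoord (i j : Fin n) (φ : 𝓢(EuclideanSpace ℝ (Fin n), ℂ))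
    (a : Fin n → ℂ) (W : EuclideanSpace ℝ (Fin n) → ℝ)  :
    pairing (SchwartzMap.compCLMOfContinuousLinearEquiv ℂ (swapCoord i j) φ)
      (a ∘ Equiv.swap i j) (W ∘ swapCoord i j) = pairing φ a W := by
  rw [pairing, pairing, ← integral_comp_swapCoord i j]
  have h : (a ∘ Equiv.swap i j) ∘ Equiv.swap i j = a := by ext l; simp
  have hx : ∀ x, swapCoord i j (swapCoord i j x) = x := fun x => by ext l; simp [swapCoord_apply]
  simp only [prodPow_swapCoord, h, Function.comp_apply, hx]
  congr 1
  ext x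
  change φ (swapCoord i j (swapCoord i j x)) * _ * _ = _
  rw [hx]

theorem exists_mul_regWeight_le {k ε : ℝ} (hk : 0 ≤ k) (hε : ε ∈ Set.Icc (0 : ℝ) 1)
    {V : EuclideanSpace ℝ (Fin n) → ℝ} {c : ℝ} (hV : ∀ x, |V x| ≤ c) :
    ∃ (C : ℝ) (M : ℕ), ∀ x, |V x * regWeight k ε x| ≤ C * (1 + ‖x‖) ^ M := by
  obtain ⟨C, M, h⟩ := exists_regWeight_le (n := n) hk
  refine ⟨c * C, M, fun x => ?_⟩
  rw [abs_mul, mul_assoc]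
  exact mul_le_mul (hV x) (h ε hε x) (abs_nonneg _) ((abs_nonneg _).trans (hV x))

theorem integrable_mul_regWeight (φ : 𝓢(EuclideanSpace ℝ (Fin n), ℂ)) {a : Fin n → ℂ}
    (ha : ∀ l, -1 < (a l).re) {k ε : ℝ} (hk : 0 ≤ k) (hε : ε ∈ Set.Icc (0 : ℝ) 1)
    {V : EuclideanSpace ℝ (Fin n) → ℝ} (hVm : Measurable V) {c : ℝ} (hV : ∀ x, |V x| ≤ c) :
    Integrable fun x => φ x * prodPow a x * (V x * regWeight k ε x : ℝ) := by
  obtain ⟨C, M, h⟩ := exists_mul_regWeight_le hk hε hV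
  exact integrable_mul_prodPow_mul φ ha (hVm.mul (measurable_regWeight k ε)) h

theorem integrable_regWeight (φ : 𝓢(EuclideanSpace ℝ (Fin n), ℂ)) {a : Fin n → ℂ}
    (ha : ∀ l, -1 < (a l).re) {k ε : ℝ} (hk : 0 ≤ k) (hε : ε ∈ Set.Icc (0 : ℝ) 1) :
    Integrable fun x => φ x * prodPow a x * (regWeight k ε x : ℝ) := by
  simpa using integrable_mul_regWeight φ ha hk hε (V := fun _ => 1) measurable_const
    (c := 1) (by simp)

/-- A crude bound for fixed `ε`, used for integrability only; the bound uniform in `ε` comes from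
the extra factor $x_i-x_j$ gained by antisymmetrisation. -/
theorem abs_div_sq_add_le {ε : ℝ} (hε : ε ∈ Set.Ioc (0 : ℝ) 1) (t : ℝ) :
    |t / (t ^ 2 + ε)| ≤ 1 / ε := by
  have h0 := hε.1
  have h1 : 0 < t ^ 2 + ε := by positivity
  rw [abs_div, abs_of_pos h1, div_le_div_iff₀ h1 h0]
  have : |t| ≤ t ^ 2 + 1 := by nlinarith [sq_abs t, sq_nonneg (|t| - 1), abs_nonneg t]
  nlinarith [hε.2, sq_nonneg t]

theorem abs_sq_div_sq_add_le {ε : ℝ} (hε : 0 < ε) (t : ℝ) : |t ^ 2 / (t ^ 2 + ε)| ≤ 1 := by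
  rw [abs_of_nonneg (by positivity)]
  exact div_le_one_of_le₀ (by linarith) (by positivity)

/-- Antisymmetrisation under the exchange of `xᵢ` and `xⱼ` removes the singularity of the
logarithmic derivative of the weight. -/
theorem two_mul_pairing_eq {k ε : ℝ} (hk : 0 ≤ k) (hε : ε ∈ Set.Ioc (0 : ℝ) 1) {i j : Fin n}
    (φ : 𝓢(EuclideanSpace ℝ (Fin n), ℂ)) {a b : Fin n → ℂ} {c : ℂ}
    (ha : ∀ l, -1 < (a l).re) (hb : ∀ l, -1 < (b l).re)
    (hab : ∀ x : EuclideanSpace ℝ (Fin n), prodPow a x - prodPow (a ∘ Equiv.swap i j) x =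
      ((x i - x j : ℝ) : ℂ) * (c * prodPow b x)) :
    2 * pairing φ a (fun x => (x i - x j) / ((x i - x j) ^ 2 + ε) * regWeight k ε x) =
      pairing (divDiffCLM i j φ) a
        (fun x => (x i - x j) ^ 2 / ((x i - x j) ^ 2 + ε) * regWeight k ε x) +
      c * pairing (SchwartzMap.compCLMOfContinuousLinearEquiv ℂ (swapCoord i j) φ) b
        (fun x => (x i - x j) ^ 2 / ((x i - x j) ^ 2 + ε) * regWeight k ε x) := by
  have hε' : ε ∈ Set.Icc (0 : ℝ) 1 := ⟨hε.1.le, hε.2⟩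
  set q : EuclideanSpace ℝ (Fin n) → ℝ := fun x => (x i - x j) / ((x i - x j) ^ 2 + ε) with hq
  have hqm : Measurable q := by fun_prop
  set r : EuclideanSpace ℝ (Fin n) → ℝ := fun x => (x i - x j) ^ 2 / ((x i - x j) ^ 2 + ε) with hr
  have hrm : Measurable r := by fun_prop
  set φ' := SchwartzMap.compCLMOfContinuousLinearEquiv ℂ (swapCoord i j) φ with hφ'
  have hq1 : ∀ x, |q x| ≤ 1 / ε := fun x => abs_div_sq_add_le hε _
  have hr1 : ∀ x, |r x| ≤ 1 := fun x => abs_sq_div_sq_add_le hε.1 _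
  -- Under the exchange the kernel `q` is odd and the weight even.
  have h1 : pairing φ a (fun x => q x * regWeight k ε x) =
      - pairing φ' (a ∘ Equiv.swap i j) (fun x => q x * regWeight k ε x) := by
    rw [← pairing_comp_swapCoord i j]
    unfold pairing
    rw [← integral_neg]
    congr 1
    ext x
    simp only [Function.comp, regWeight_swapCoord, hq, swapCoord_apply, Equiv.swap_apply_left,
      Equiv.swap_apply_right]
    rw [show (x j - x i) / ((x j - x i) ^ 2 + ε) = -((x i - x j) / ((x i - x j) ^ 2 + ε)) by
      rw [← neg_sub (x i), neg_sq, neg_div]]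
    push_cast
    ring
  have h2 : 2 * pairing φ a (fun x => q x * regWeight k ε x) =
      pairing φ a (fun x => q x * regWeight k ε x) -
      pairing φ' (a ∘ Equiv.swap i j) (fun x => q x * regWeight k ε x) := by
    rw [two_mul]
    nth_rewrite 2 [h1]
    ring
  change 2 * pairing φ a (fun x => q x * regWeight k ε x) =
    pairing _ a (fun x => r x * regWeight k ε x) + c * pairing _ b (fun x => r x * regWeight k ε x)
  rw [h2]
  unfold pairing
  beta_reduce
  rw [← integral_sub (integrable_mul_regWeight _ ha hk hε' hqm hq1)
    (integrable_mul_regWeight _ (a := a ∘ Equiv.swap i j) (fun l => ha _) hk hε' hqm hq1), ← integral_const_mul,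
    ← integral_add (integrable_mul_regWeight _ ha hk hε' hrm hr1)
    ((integrable_mul_regWeight _ hb hk hε' hrm hr1).const_mul c)]
  congr 1
  ext x
  -- With $P'$ the swapped product, $\varphi P-\varphi'P'=(\varphi-\varphi')P+\varphi'(P-P')$. Each
  -- difference carries a factor $x_i-x_j$, which turns `q` into the bounded `r`.
  have e1 := hab x
  have e2 := mul_divDiff i j φ x
  have e3 : φ' x = φ (swapCoord i j x) := rfl
  have e4 : r x = (x i - x j) * q x := by simp only [q, r]; ring
  rw [e4, divDiffCLM_apply, e3]
  push_cast at e1 e2 ⊢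
  linear_combination (q x * prodPow a x * regWeight k ε x : ℂ) * -e2 +
    φ (swapCoord i j x) * q x * regWeight k ε x * e1

/-! ### Integration by parts with the regularised weight -/

theorem hasDerivAt_regWeight (k : ℝ) {ε : ℝ} (hε : 0 < ε) (x : EuclideanSpace ℝ (Fin n))
    (i : Fin n) :
    HasLineDerivAt ℝ (regWeight k ε) (∑ j ∈ Finset.univ.erase i,
      2 * k * ((x i - x j) / ((x i - x j) ^ 2 + ε) * regWeight k ε x)) x
      (EuclideanSpace.single i 1) := by
  let S : EuclideanSpace ℝ (Fin n) → ℝ := fun y =>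
    ∑ p, ∑ j ∈ {p}ᶜ, Real.log ((y p - y j) ^ 2 + ε) * (k / 2)
  have hS : (regWeight k ε : EuclideanSpace ℝ (Fin n) → ℝ) = fun y => Real.exp (S y) := by
    ext y
    simp only [S, regWeight, Real.exp_sum]
    refine Finset.prod_congr rfl fun p _ => Finset.prod_congr rfl fun j _ => ?_
    exact Real.rpow_def_of_pos (by positivity) _
  let d : Fin n → ℝ := fun p => if p = i then 1 else 0
  have hc : ∀ (t : ℝ) p, (x + t • EuclideanSpace.single i (1 : ℝ)) p = x p + t * d p := by
    intro t p
    simp [d, PiLp.single_apply]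
  have hd : HasDerivAt (fun t : ℝ => S (x + t • EuclideanSpace.single i (1 : ℝ)))
      (∑ p, ∑ j ∈ {p}ᶜ, 2 * (x p - x j) * (d p - d j) / ((x p - x j) ^ 2 + ε) * (k / 2)) 0 := by
    simp only [S, hc]
    refine HasDerivAt.fun_sum fun p _ => HasDerivAt.fun_sum fun j _ => HasDerivAt.mul_const ?_ _
    have h1 : HasDerivAt (fun t : ℝ => (x p + t * d p - (x j + t * d j)) ^ 2 + ε)
        (2 * (x p - x j) * (d p - d j)) 0 := by
      have h2 : ∀ p, HasDerivAt (fun t : ℝ => x p + t * d p) (d p) 0 := fun p => by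
        simpa using ((hasDerivAt_id (0 : ℝ)).mul_const (d p)).const_add (x p)
      have := (((h2 p).sub (h2 j)).pow 2).add_const ε
      simpa using this
    have := h1.log (by positivity)
    simpa using this
  have hsum : ∑ p, ∑ j ∈ {p}ᶜ, 2 * (x p - x j) * (d p - d j) / ((x p - x j) ^ 2 + ε) * (k / 2) =
      ∑ j ∈ Finset.univ.erase i, 2 * k * ((x i - x j) / ((x i - x j) ^ 2 + ε)) := by
    -- Only ordered pairs containing `i` survive; $(i,j)$ and $(j,i)$ contribute equally, which
    -- gives the coefficient $2k$.
    have e : ∀ p j, 2 * (x p - x j) * (d p - d j) / ((x p - x j) ^ 2 + ε) * (k / 2) =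
        (if p = i then k * ((x p - x j) / ((x p - x j) ^ 2 + ε)) else 0) +
        (if j = i then k * ((x j - x p) / ((x j - x p) ^ 2 + ε)) else 0) := by
      intro p j
      rw [show (x j - x p) / ((x j - x p) ^ 2 + ε) = -((x p - x j) / ((x p - x j) ^ 2 + ε)) by
        rw [← neg_sub (x p), neg_sq, neg_div]]
      simp only [d]
      split_ifs <;> ring
    simp_rw [e, Finset.sum_add_distrib]
    have e1 : ∑ p, ∑ j ∈ {p}ᶜ, (if p = i then k * ((x p - x j) / ((x p - x j) ^ 2 + ε)) else 0) =
        ∑ j ∈ Finset.univ.erase i, k * ((x i - x j) / ((x i - x j) ^ 2 + ε)) := by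
      rw [Finset.sum_eq_single i (fun p _ hp => Finset.sum_eq_zero fun j _ => if_neg hp)
        (fun h => absurd (Finset.mem_univ i) h)]
      refine Finset.sum_congr (by ext; simp) fun j _ => if_pos rfl
    have e2 : ∑ p, ∑ j ∈ {p}ᶜ, (if j = i then k * ((x j - x p) / ((x j - x p) ^ 2 + ε)) else 0) =
        ∑ j ∈ Finset.univ.erase i, k * ((x i - x j) / ((x i - x j) ^ 2 + ε)) := by
      simp_rw [Finset.sum_ite_eq']
      rw [← Finset.sum_filter]
      refine Finset.sum_congr ?_ fun _ _ => rfl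
      ext p
      simp [eq_comm]
    rw [e1, e2, ← Finset.sum_add_distrib]
    exact Finset.sum_congr rfl fun j _ => by ring
  unfold HasLineDerivAt
  rw [hS]
  refine hd.exp.congr_deriv ?_
  rw [hsum]
  simp only [zero_smul, add_zero, Finset.mul_sum]
  exact Finset.sum_congr rfl fun j _ => by ring

theorem hasLineDerivAt_prodPow {a : Fin n → ℂ} {i : Fin n} (ha : 1 < (a i).re)
    (x : EuclideanSpace ℝ (Fin n)) :
    HasLineDerivAt ℝ (prodPow a) (a i * prodPow (Function.update a i (a i - 1)) x) x
      (EuclideanSpace.single i 1) := by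
  have h1 : ∀ (t : ℝ), prodPow a (x + t • EuclideanSpace.single i (1 : ℝ)) =
      posPow (a i) (x i + t) * ∏ l ∈ Finset.univ.erase i, posPow (a l) (x l) := by
    intro t
    rw [prodPow, ← Finset.mul_prod_erase _ _ (Finset.mem_univ i)]
    congr 1
    · simp
    · refine Finset.prod_congr rfl fun l hl => ?_
      simp [Finset.ne_of_mem_erase hl]
  have h2 : prodPow (Function.update a i (a i - 1)) x =
      posPow (a i - 1) (x i) * ∏ l ∈ Finset.univ.erase i, posPow (a l) (x l) := by
    rw [prodPow, ← Finset.mul_prod_erase _ _ (Finset.mem_univ i)]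
    congr 1
    · simp
    · refine Finset.prod_congr rfl fun l hl => ?_
      simp [Finset.ne_of_mem_erase hl]
  unfold HasLineDerivAt
  simp only [h1, h2]
  rw [← mul_assoc]
  have h3 : HasDerivAt (fun t : ℝ => posPow (a i) (x i + t)) (a i * posPow (a i - 1) (x i)) 0 := by
    have := hasDerivAt_posPow ha (x i + 0)
    rw [add_zero] at this
    exact HasDerivAt.comp_const_add (x i) 0 (by rwa [add_zero])
  exact h3.mul_const _

/-- Integration by parts against the regularised weight. -/
theorem pairing_lineDeriv_add_eq_zero {k ε : ℝ} (hk : 0 ≤ k) (hε : ε ∈ Set.Ioc (0 : ℝ) 1)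
    {i : Fin n} (φ : 𝓢(EuclideanSpace ℝ (Fin n), ℂ)) {a : Fin n → ℂ}
    (ha : ∀ l, -1 < (a l).re) (hai : 1 < (a i).re) :
    pairing (∂_{EuclideanSpace.single i (1 : ℝ)} φ) a (regWeight k ε) +
      a i * pairing φ (Function.update a i (a i - 1)) (regWeight k ε) +
      ∑ j ∈ Finset.univ.erase i, k * (2 * pairing φ a
        (fun x => (x i - x j) / ((x i - x j) ^ 2 + ε) * regWeight k ε x)) = 0 := by
  have hε' : ε ∈ Set.Icc (0 : ℝ) 1 := ⟨hε.1.le, hε.2⟩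
  have hb : ∀ l, -1 < (Function.update a i (a i - 1) l).re := fun l => by
    by_cases h : l = i
    · subst h; simp; linarith
    · simpa [h] using ha l
  have i1 := integrable_regWeight (∂_{EuclideanSpace.single i (1 : ℝ)} φ) ha hk hε'
  have i2 := (integrable_regWeight φ hb hk hε').const_mul (a i)
  have i3 : ∀ j, Integrable fun x => (k : ℂ) * (2 * (φ x * prodPow a x *
      ((x i - x j) / ((x i - x j) ^ 2 + ε) * regWeight k ε x : ℝ))) := fun j =>
    ((integrable_mul_regWeight φ ha hk hε' (by fun_prop)
      (fun x => abs_div_sq_add_le hε _)).const_mul 2).const_mul (k : ℂ)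
  have i12 : Integrable fun x =>
      (∂_{EuclideanSpace.single i (1 : ℝ)} φ) x * prodPow a x * regWeight k ε x +
      a i * (φ x * prodPow (Function.update a i (a i - 1)) x * regWeight k ε x) := i1.add i2
  have i4 := integrable_finsetSum (Finset.univ.erase i) fun j _ => i3 j
  let f' : EuclideanSpace ℝ (Fin n) → ℂ := fun x =>
    (∂_{EuclideanSpace.single i (1 : ℝ)} φ) x * prodPow a x * regWeight k ε x +
    a i * (φ x * prodPow (Function.update a i (a i - 1)) x * regWeight k ε x) +
    ∑ j ∈ Finset.univ.erase i, (k : ℂ) * (2 * (φ x * prodPow a x *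
      ((x i - x j) / ((x i - x j) ^ 2 + ε) * regWeight k ε x : ℝ)))
  have hf' : Integrable f' := i12.add i4
  have hder : ∀ x, HasLineDerivAt ℝ (fun x => φ x * prodPow a x * (regWeight k ε x : ℝ)) (f' x) x
      (EuclideanSpace.single i 1) := by
    intro x
    have d1 := (φ.hasFDerivAt x).hasLineDerivAt (EuclideanSpace.single i (1 : ℝ))
    have d2 := hasLineDerivAt_prodPow hai x
    have d3 := HasDerivAt.ofReal_comp (hasDerivAt_regWeight k hε.1 x i)
    have := (HasDerivAt.mul (HasDerivAt.mul d1 d2) d3)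
    refine HasDerivAt.congr_deriv this ?_
    simp only [zero_smul, add_zero, f', SchwartzMap.lineDerivOp_apply_eq_fderiv, Pi.mul_apply]
    have e : ∑ j ∈ Finset.univ.erase i, (k : ℂ) * (2 * (φ x * prodPow a x *
        ((x i - x j) / ((x i - x j) ^ 2 + ε) * regWeight k ε x : ℝ))) = φ x * prodPow a x *
        ((∑ j ∈ Finset.univ.erase i,
      2 * k * ((x i - x j) / ((x i - x j) ^ 2 + ε) * regWeight k ε x) : ℝ) : ℂ) := by
      push_cast
      rw [Finset.mul_sum]
      exact Finset.sum_congr rfl fun j _ => by ring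
    rw [e]
    ring
  -- Integration by parts against the constant $1$: the integral of the derivative of an integrable
  -- function vanishes if that derivative is integrable.
  have main := integral_bilinear_hasLineDerivAt_right_eq_neg_left_of_integrable
    (μ := (volume : Measure (EuclideanSpace ℝ (Fin n))))
    (f := fun x => φ x * prodPow a x * (regWeight k ε x : ℝ)) (f' := f') (g := fun _ => (1 : ℂ))
    (g' := fun _ => 0) (v := EuclideanSpace.single i (1 : ℝ)) (B := ContinuousLinearMap.mul ℝ ℂ)
    (by simpa using hf') (by simp) (by simpa using integrable_regWeight φ ha hk hε')
    (fun x _ => hder x) (fun x _ => hasDerivAt_const _ _)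
  simp only [ContinuousLinearMap.mul_apply', mul_zero, integral_zero, mul_one] at main
  have h0 : ∫ x, f' x = 0 := neg_eq_zero.1 main.symm
  simp only [f'] at h0
  rw [integral_add i12 i4, integral_add i1 i2, integral_finsetSum _ fun j _ => i3 j] at h0
  simp_rw [integral_const_mul] at h0
  exact h0

/-! ### Removing the regularisation -/

/-- Dominated convergence. `V` will be either $1$ or $(x_i-x_j)^2/((x_i-x_j)^2+\varepsilon)$. -/
theorem tendsto_pairing {k : ℝ} (hk : 0 ≤ k) (φ : 𝓢(EuclideanSpace ℝ (Fin n), ℂ))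
    {a : Fin n → ℂ} (ha : ∀ l, -1 < (a l).re) {V : ℝ → EuclideanSpace ℝ (Fin n) → ℝ}
    (hVm : ∀ ε, Measurable (V ε)) (hV : ∀ ε > 0, ∀ x, |V ε x| ≤ 1)
    (hlim : ∀ x, Tendsto (fun ε => V ε x * regWeight k ε x) (𝓝[>] 0) (𝓝 (weight k x))) :
    Tendsto (fun ε => pairing φ a fun x => V ε x * regWeight k ε x) (𝓝[>] 0)
      (𝓝 (pairing φ a (weight k))) := by
  obtain ⟨C, M, hC⟩ := exists_regWeight_le (n := n) hk
  obtain ⟨N, B, hB, h⟩ := exists_integrable_bound a ha M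
  have hC0 : 0 ≤ C := by
    have := (abs_nonneg _).trans (hC 0 (by simp) 0)
    exact nonneg_of_mul_nonneg_left this (by positivity)
  refine tendsto_integral_filter_of_dominated_convergence (fun x => C *
    (2 ^ N * (Finset.Iic (N, 0)).sup (schwartzSeminormFamily ℂ _ ℂ) φ * B x)) ?_ ?_
    ((hB.const_mul _).const_mul C) ?_
  · exact Eventually.of_forall fun ε => ((φ.continuous.measurable.mul (measurable_prodPow a)).mul
      ((hVm ε).mul (measurable_regWeight k ε)).complex_ofReal).aestronglyMeasurable
  · filter_upwards [Ioc_mem_nhdsGT (zero_lt_one (α := ℝ))] with ε hε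
    refine Eventually.of_forall fun x => ?_
    rw [norm_mul, norm_mul, Complex.norm_real, Real.norm_eq_abs]
    have h1 : |V ε x * regWeight k ε x| ≤ C * (1 + ‖x‖) ^ M := by
      rw [abs_mul]
      exact (mul_le_of_le_one_left (abs_nonneg _) (hV ε hε.1 x)).trans (hC ε ⟨hε.1.le, hε.2⟩ x)
    calc _ ≤ ‖φ x‖ * ‖prodPow a x‖ * (C * (1 + ‖x‖) ^ M) := by gcongr
      _ = C * (‖φ x‖ * ‖prodPow a x‖ * (1 + ‖x‖) ^ M) := by ring
      _ ≤ _ := mul_le_mul_of_nonneg_left (h φ x) hC0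
  · refine Eventually.of_forall fun x => ?_
    have h1 : Tendsto (fun ε => ((V ε x * regWeight k ε x : ℝ) : ℂ)) (𝓝[>] 0)
        (𝓝 (weight k x : ℂ)) := (hlim x).ofReal
    exact h1.const_mul (φ x * prodPow a x)

theorem tendsto_regWeight {k : ℝ} (hk : 0 ≤ k) (x : EuclideanSpace ℝ (Fin n)) :
    Tendsto (fun ε => regWeight k ε x) (𝓝[>] 0) (𝓝 (weight k x)) := by
  rw [← regWeight_zero hk]
  exact ((continuous_regWeight hk x).tendsto 0).mono_left nhdsWithin_le_nhds

theorem weight_eq_zero {k : ℝ} (hk : 0 < k) {i j : Fin n} (hij : i ≠ j)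
    {x : EuclideanSpace ℝ (Fin n)} (hx : x i = x j) : weight k x = 0 := by
  rw [← regWeight_zero hk.le]
  refine Finset.prod_eq_zero (Finset.mem_univ i) (Finset.prod_eq_zero (i := j) ?_ ?_)
  · simpa using hij.symm
  · rw [hx, sub_self, zero_pow two_ne_zero, add_zero, Real.zero_rpow (by positivity)]

/-- The quotient tends to $1$ off the hyperplane $x_i=x_j$ and is $0$ on it. The limit is right
there too because $k>0$ makes the weight vanish. -/
theorem tendsto_quotient_mul_regWeight {k : ℝ} (hk : 0 < k) {i j : Fin n} (hij : i ≠ j)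
    (x : EuclideanSpace ℝ (Fin n)) :
    Tendsto (fun ε => (x i - x j) ^ 2 / ((x i - x j) ^ 2 + ε) * regWeight k ε x) (𝓝[>] 0)
      (𝓝 (weight k x)) := by
  by_cases hx : x i = x j
  · rw [weight_eq_zero hk hij hx]
    simp [hx]
  · have h0 : (x i - x j) ^ 2 ≠ 0 := pow_ne_zero 2 (sub_ne_zero.2 hx)
    have h1 : Tendsto (fun ε : ℝ => (x i - x j) ^ 2 / ((x i - x j) ^ 2 + ε)) (𝓝 0) (𝓝 1) := by
      have : ContinuousAt (fun ε : ℝ => (x i - x j) ^ 2 / ((x i - x j) ^ 2 + ε)) 0 :=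
        ContinuousAt.div (by fun_prop) (by fun_prop) (by simpa using h0)
      simpa [ContinuousAt, h0] using this
    simpa using (h1.mono_left nhdsWithin_le_nhds).mul (tendsto_regWeight hk.le x)

theorem mul_prodPow (a : Fin n → ℂ) (i : Fin n) (x : EuclideanSpace ℝ (Fin n)) :
    (x i : ℂ) * prodPow a x = prodPow (Function.update a i (a i + 1)) x := by
  rw [prodPow, prodPow, ← Finset.mul_prod_erase _ _ (Finset.mem_univ i),
    ← Finset.mul_prod_erase _ _ (Finset.mem_univ i), ← mul_assoc, mul_posPow]
  congr 1
  · simp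
  · exact Finset.prod_congr rfl fun l hl => by simp [Finset.ne_of_mem_erase hl]

/-- With $Q$ the product in which both exponents are $a_i-1$, the two terms are $x_iQ$ and $x_jQ$.
-/
theorem prodPow_sub_prodPow_swap {a : Fin n → ℂ} {i j : Fin n} (hij : j ≠ i)
    (h : a j = a i - 1) (x : EuclideanSpace ℝ (Fin n)) :
    prodPow a x - prodPow (a ∘ Equiv.swap i j) x =
      ((x i - x j : ℝ) : ℂ) * prodPow (Function.update a i (a i - 1)) x := by
  have h1 := mul_prodPow (Function.update a i (a i - 1)) i x
  have h2 := mul_prodPow (Function.update a i (a i - 1)) j x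
  have e1 : Function.update (Function.update a i (a i - 1)) i
      (Function.update a i (a i - 1) i + 1) = a := by simp
  have e2 : Function.update (Function.update a i (a i - 1)) j
      (Function.update a i (a i - 1) j + 1) = a ∘ Equiv.swap i j := by
    ext l
    by_cases hl : l = j
    · subst hl; simp [hij, h]
    · by_cases hl' : l = i
      · subst hl'; simp [hl, h]
      · simp [hl, hl', Equiv.swap_apply_of_ne_of_ne hl' hl]
  rw [e1] at h1
  rw [e2] at h2
  rw [← h1, ← h2]
  push_cast
  ring

/-- The Dunkl operator applied to a product of powers, moved to the other side of the weighted
pairing. -/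
theorem pairing_dunkl_eq {k : ℝ} (hk : 0 ≤ k) {i : Fin n}
    (φ : 𝓢(EuclideanSpace ℝ (Fin n), ℂ)) {a c : Fin n → ℂ} (ha : ∀ l, -1 < (a l).re)
    (hai : 1 < (a i).re)
    (hc : ∀ j ≠ i, (a j = a i ∧ c j = 0) ∨ (a j = a i - 1 ∧ c j = 1)) :
    pairing (∂_{EuclideanSpace.single i (1 : ℝ)} φ) a (weight k) +
      a i * pairing φ (Function.update a i (a i - 1)) (weight k) +
      ∑ j ∈ Finset.univ.erase i, k * (pairing (divDiffCLM i j φ) a (weight k) +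
        c j * pairing φ (Function.update a i (a i - 1)) (weight k)) = 0 := by
  set b := Function.update a i (a i - 1) with hb'
  have hb : ∀ l, -1 < (b l).re := fun l => by
    by_cases h : l = i
    · subst h; simp [b]; linarith
    · simpa [b, h] using ha l
  have hlim1 : ∀ (ψ : 𝓢(EuclideanSpace ℝ (Fin n), ℂ)) {a : Fin n → ℂ}, (∀ l, -1 < (a l).re) →
      Tendsto (fun ε => pairing ψ a (regWeight k ε)) (𝓝[>] 0) (𝓝 (pairing ψ a (weight k))) := by
    intro ψ a ha
    simpa using tendsto_pairing hk ψ ha (V := fun _ _ => 1) (fun _ => measurable_const)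
      (fun _ _ _ => by simp) (fun x => by simpa using tendsto_regWeight hk x)
  have hlim2 : ∀ j ≠ i, Tendsto (fun ε => (k : ℂ) * (2 * pairing φ a
      (fun x => (x i - x j) / ((x i - x j) ^ 2 + ε) * regWeight k ε x))) (𝓝[>] 0)
      (𝓝 (k * (pairing (divDiffCLM i j φ) a (weight k) + c j * pairing φ b (weight k)))) := by
    intro j hj
    -- For $k=0$ the prefactor kills both sides; the limit on the hyperplane needs $k>0$.
    rcases hk.eq_or_lt with h0 | h0
    · simp [← h0]
    refine Tendsto.const_mul _ ?_
    have hab : ∀ x : EuclideanSpace ℝ (Fin n), prodPow a x - prodPow (a ∘ Equiv.swap i j) x =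
        ((x i - x j : ℝ) : ℂ) * (c j * prodPow b x) := by
      intro x
      rcases hc j hj with ⟨h1, h2⟩ | ⟨h1, h2⟩
      · have : a ∘ Equiv.swap i j = a := by
          ext l
          by_cases hl : l = i
          · subst hl; simp [h1]
          · by_cases hl' : l = j
            · subst hl'; simp [h1]
            · simp [Equiv.swap_apply_of_ne_of_ne hl hl']
        rw [this, h2]
        ring
      · rw [h2, one_mul]
        exact prodPow_sub_prodPow_swap hj h1 x
    -- Antisymmetrisation leaves $\varphi\circ\sigma_{ij}$ in the second term. When $c_j=1$ the
    -- lowered exponents at `i` and `j` agree, so the exchange can be undone.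
    have hsymm : c j * pairing (SchwartzMap.compCLMOfContinuousLinearEquiv ℂ (swapCoord i j) φ) b
        (weight k) = c j * pairing φ b (weight k) := by
      rcases hc j hj with ⟨h1, h2⟩ | ⟨h1, h2⟩
      · simp [h2]
      · have e1 : b ∘ Equiv.swap i j = b := by
          ext l
          by_cases hl : l = i
          · subst hl; simp [b, h1, hj]
          · by_cases hl' : l = j
            · subst hl'; simp [b, h1, hj]
            · simp [Equiv.swap_apply_of_ne_of_ne hl hl']
        have e2 : weight k ∘ swapCoord i j = weight k := by
          ext x
          simp only [Function.comp, ← regWeight_zero hk, regWeight_swapCoord]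
        have := pairing_comp_swapCoord i j φ b (weight k)
        rw [e1, e2] at this
        rw [this]
    have hr : ∀ (ψ : 𝓢(EuclideanSpace ℝ (Fin n), ℂ)) {a : Fin n → ℂ}, (∀ l, -1 < (a l).re) →
        Tendsto (fun ε => pairing ψ a
          fun x => (x i - x j) ^ 2 / ((x i - x j) ^ 2 + ε) * regWeight k ε x)
          (𝓝[>] 0) (𝓝 (pairing ψ a (weight k))) := fun ψ a ha =>
      tendsto_pairing hk ψ ha (fun _ => by fun_prop) (fun ε hε x => abs_sq_div_sq_add_le hε _)
        (tendsto_quotient_mul_regWeight h0 hj.symm)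
    rw [← hsymm]
    refine ((hr (divDiffCLM i j φ) ha).add ((hr _ hb).const_mul (c j))).congr' ?_
    filter_upwards [Ioc_mem_nhdsGT (zero_lt_one (α := ℝ))] with ε hε
    exact (two_mul_pairing_eq hk hε φ ha hb hab).symm
  refine tendsto_nhds_unique (((hlim1 _ ha).add ((hlim1 φ hb).const_mul (a i))).add
    (tendsto_finsetSum _ fun j hj => hlim2 j (Finset.ne_of_mem_erase hj))) ?_
  refine tendsto_const_nhds.congr' ?_
  filter_upwards [Ioc_mem_nhdsGT (zero_lt_one (α := ℝ))] with ε hε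
  exact (pairing_lineDeriv_add_eq_zero hk hε φ ha hai).symm

/-! ### The tempered distributions and the Bernstein identity -/

theorem integrable_weight {k : ℝ} (hk : 0 ≤ k) (φ : 𝓢(EuclideanSpace ℝ (Fin n), ℂ))
    {a : Fin n → ℂ} (ha : ∀ l, -1 < (a l).re) :
    Integrable fun x => φ x * prodPow a x * (weight k x : ℝ) := by
  obtain ⟨C, M, h⟩ := exists_weight_le (n := n) hk
  exact integrable_mul_prodPow_mul φ ha (measurable_weight hk) h

/-- The functional `φ ↦ ∫ φ ∏ xₗ₊^{aₗ} ω_k` on the Schwartz space. -/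
noncomputable def pairingCLM {k : ℝ} (hk : 0 ≤ k) {a : Fin n → ℂ} (ha : ∀ l, -1 < (a l).re) :
    𝓢(EuclideanSpace ℝ (Fin n), ℂ) →L[ℂ] ℂ :=
  SchwartzMap.mkCLMtoNormedSpace (σ := RingHom.id ℂ) (fun φ => pairing φ a (weight k))
    (fun φ ψ => by
      unfold pairing
      rw [← integral_add (integrable_weight hk φ ha) (integrable_weight hk ψ ha)]
      simp only [add_apply, add_mul])
    (fun z φ => by
      unfold pairing
      rw [RingHom.id_apply, smul_eq_mul, ← integral_const_mul]
      simp only [smul_apply, smul_eq_mul, mul_assoc])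
    (by
      obtain ⟨C, M, hC⟩ := exists_weight_le (n := n) hk
      obtain ⟨N, B, hB, h⟩ := exists_integrable_bound a ha M
      have hC0 : 0 ≤ C := by
        have := (abs_nonneg _).trans (hC 0)
        exact nonneg_of_mul_nonneg_left this (by positivity)
      refine ⟨Finset.Iic (N, 0), C * 2 ^ N * ∫ x, |B x|, by positivity, fun φ => ?_⟩
      set p := (Finset.Iic (N, 0)).sup (schwartzSeminormFamily ℂ
        (EuclideanSpace ℝ (Fin n)) ℂ) φ with hp
      have hp0 : 0 ≤ p := apply_nonneg _ _
      refine (norm_integral_le_of_norm_le ((hB.abs.const_mul (2 ^ N * p)).const_mul C)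
        (Eventually.of_forall fun x => ?_)).trans (le_of_eq ?_)
      · rw [norm_mul, norm_mul, Complex.norm_real, Real.norm_eq_abs]
        calc _ ≤ ‖φ x‖ * ‖prodPow a x‖ * (C * (1 + ‖x‖) ^ M) := by gcongr; exact hC x
          _ = C * (‖φ x‖ * ‖prodPow a x‖ * (1 + ‖x‖) ^ M) := by ring
          _ ≤ C * (2 ^ N * p * B x) := mul_le_mul_of_nonneg_left (h φ x) hC0
          _ ≤ C * (2 ^ N * p * |B x|) := by gcongr; exact le_abs_self _
      · rw [integral_const_mul, integral_const_mul]
        ring)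

open Classical in
/-- The tempered distribution `φ ↦ ∫ φ ∏ xₗ₊^{aₗ} ω_k`, for `Re aₗ > -1`. -/
noncomputable def prodPowDist (k : ℝ) (a : Fin n → ℂ) : 𝓢'(EuclideanSpace ℝ (Fin n), ℂ) :=
  if h : 0 ≤ k ∧ ∀ l, -1 < (a l).re then
    ContinuousLinearMap.toPointwiseConvergenceCLM _ _ _ _ (pairingCLM h.1 h.2)
  else 0

theorem prodPowDist_apply {k : ℝ} (hk : 0 ≤ k) {a : Fin n → ℂ} (ha : ∀ l, -1 < (a l).re)
    (φ : 𝓢(EuclideanSpace ℝ (Fin n), ℂ)) : prodPowDist k a φ = pairing φ a (weight k) := by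
  rw [prodPowDist, dif_pos ⟨hk, ha⟩]
  rfl

theorem dunklDist_apply (k : ℝ) (i : Fin n) (u : 𝓢'(EuclideanSpace ℝ (Fin n), ℂ))
    (φ : 𝓢(EuclideanSpace ℝ (Fin n), ℂ)) : dunklDist k i u φ = -u (dunklOp k i φ) := by
  change u (-dunklOp k i φ) = _
  exact map_neg _ _

theorem dunklOp_apply (k : ℝ) (i : Fin n) (φ : 𝓢(EuclideanSpace ℝ (Fin n), ℂ)) :
    dunklOp k i φ = ∂_{EuclideanSpace.single i (1 : ℝ)} φ +
      (k : ℂ) • ∑ j ∈ Finset.univ.erase i, divDiffCLM i j φ := by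
  simp only [dunklOp, add_apply, smul_apply, sum_apply]
  rfl

/-- The derivative and the divided differences in `pairing_dunkl_eq` reassemble to $T_i(k)\varphi$.
Each `j` with exponent $a_i-1$ adds $k$ to the eigenvalue-like factor $a_i$. -/
theorem dunklDist_prodPowDist {k : ℝ} (hk : 0 ≤ k) {i : Fin n} {a c : Fin n → ℂ}
    (ha : ∀ l, -1 < (a l).re) (hai : 1 < (a i).re)
    (hc : ∀ j ≠ i, (a j = a i ∧ c j = 0) ∨ (a j = a i - 1 ∧ c j = 1)) :
    dunklDist k i (prodPowDist k a) =
      (a i + k * ∑ j ∈ Finset.univ.erase i, c j) •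
        prodPowDist k (Function.update a i (a i - 1)) := by
  have hb : ∀ l, -1 < (Function.update a i (a i - 1) l).re := fun l => by
    by_cases h : l = i
    · subst h; simp; linarith
    · simpa [h] using ha l
  ext φ
  rw [dunklDist_apply, dunklOp_apply, map_add, map_smul, map_sum]
  change _ = (a i + k * ∑ j ∈ Finset.univ.erase i, c j) * prodPowDist k _ φ
  simp only [prodPowDist_apply hk ha, prodPowDist_apply hk hb, smul_eq_mul]
  have := pairing_dunkl_eq hk φ ha hai hc
  rw [← Finset.mul_sum, Finset.sum_add_distrib, ← Finset.sum_mul] at this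
  linear_combination -this

/-- The last factor of the product acts first, so the chain descends from `J n` to `J 0`. -/
theorem prod_ofFn_apply_eq {V : Type*} [AddCommGroup V] [Module ℂ V] [TopologicalSpace V] :
    ∀ (n : ℕ) (A : Fin n → V →L[ℂ] V) (J : ℕ → V) (c : ℕ → ℂ),
      (∀ i : Fin n, A i (J (i + 1)) = c i • J i) →
      (List.ofFn A).prod (J n) = (∏ i ∈ Finset.range n, c i) • J 0
  | 0, _, _, _, _ => by simp
  | n + 1, A, J, c, h => by
    rw [List.ofFn_succ', List.concat_eq_append, List.prod_append, List.prod_singleton,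
      Finset.prod_range_succ]
    have h1 := h (Fin.last n)
    rw [Fin.val_last] at h1
    rw [mul_apply_eq_comp, h1, map_smul,
      prod_ofFn_apply_eq n (fun i => A i.castSucc) J c (fun i => h i.castSucc), smul_smul,
      mul_comm]

/-- The Bernstein identity for the Dunkl operators of type `A`. -/
theorem dunklProdDist_prodPowDist {k : ℝ} (hk : 0 ≤ k) {s : ℂ} (hs : 1 < s.re) :
    dunklProdDist n k (prodPowDist k fun _ => s) =
      (∏ i ∈ Finset.range n, (s + k * ((n : ℂ) - 1 - i))) • prodPowDist k fun _ => s - 1 := by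
  -- Coordinates of index at least `m` are already lowered. When $T_i(k)$ acts, the exponents with
  -- $j<i$ equal that of `i` and the $n-1-i$ with $j>i$ are smaller by one (indices from $0$).
  let J : ℕ → 𝓢'(EuclideanSpace ℝ (Fin n), ℂ) := fun m =>
    prodPowDist k fun l => if m ≤ (l : ℕ) then s - 1 else s
  have h := prod_ofFn_apply_eq n (fun i : Fin n => dunklDist k i) J
    (fun i => s + k * ((n : ℂ) - 1 - i)) (fun i => ?_)
  · have e0 : J 0 = prodPowDist k fun _ => s - 1 := by simp [J]
    have en : J n = prodPowDist k fun _ => s := by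
      simp only [J, not_le.2 (Fin.is_lt _), if_false]
    rw [e0, en] at h
    exact h
  · have key := dunklDist_prodPowDist hk (i := i)
      (a := fun l => if (i : ℕ) + 1 ≤ (l : ℕ) then s - 1 else s)
      (c := fun j => if i < j then 1 else 0) (fun l => ?_) ?_ (fun j hj => ?_)
    · have e1 : ∑ j ∈ Finset.univ.erase i, (if i < j then 1 else 0 : ℂ) = (n : ℂ) - 1 - i := by
        rw [Finset.sum_boole]
        have : (Finset.univ.erase i).filter (fun j => i < j) = Finset.Ioi i := by
          ext j
          simp only [Finset.mem_filter, Finset.mem_erase, Finset.mem_univ, and_true,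
            Finset.mem_Ioi, and_iff_right_iff_imp]
          exact fun h => h.ne'
        rw [this, Fin.card_Ioi, Nat.sub_sub, Nat.cast_sub (by omega)]
        push_cast
        ring
      have e2 : Function.update (fun l : Fin n => if (i : ℕ) + 1 ≤ (l : ℕ) then s - 1 else s) i
          ((fun l : Fin n => if (i : ℕ) + 1 ≤ (l : ℕ) then s - 1 else s) i - 1) =
          fun l : Fin n => if (i : ℕ) ≤ (l : ℕ) then s - 1 else s := by
        ext l
        by_cases hl : l = i
        · subst hl; simp
        · have : (l : ℕ) ≠ i := fun h => hl (Fin.ext h)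
          have h3 : ((i : ℕ) + 1 ≤ (l : ℕ)) = ((i : ℕ) ≤ (l : ℕ)) := by
            apply propext; omega
          simp only [Function.update_of_ne hl, h3]
      rw [e1, e2] at key
      simp only [Nat.not_succ_le_self, if_false] at key
      exact key
    · split_ifs
      · simp; linarith
      · linarith
    · simpa using hs
    · by_cases h : i < j
      · right
        have : (i : ℕ) + 1 ≤ j := h
        simp [h, this]
      · left
        have : ¬ (i : ℕ) + 1 ≤ j := h
        simp [h, this]

/-! ### Holomorphy in the exponent -/

theorem prodPow_const_of_pos (s : ℂ) {x : EuclideanSpace ℝ (Fin n)} (hx : ∀ i, 0 < x i) :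
    prodPow (fun _ => s) x = ((∏ i, x i : ℝ) : ℂ) ^ s := by
  have h : ∀ S : Finset (Fin n), ∏ i ∈ S, posPow s (x i) = ((∏ i ∈ S, x i : ℝ) : ℂ) ^ s := by
    intro S
    induction S using Finset.cons_induction with
    | empty => simp
    | cons i S hi ih =>
      rw [Finset.prod_cons, Finset.prod_cons, ih, Complex.ofReal_mul,
        Complex.mul_cpow_ofReal_nonneg (hx i).le (Finset.prod_nonneg fun j _ => (hx j).le),
        posPow, if_pos (hx i)]
  exact h _

theorem prodPow_of_not_pos (a : Fin n → ℂ) {x : EuclideanSpace ℝ (Fin n)}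
    (hx : ¬ ∀ i, 0 < x i) : prodPow a x = 0 := by
  obtain ⟨i, hi⟩ := not_forall.1 hx
  exact Finset.prod_eq_zero (Finset.mem_univ i) (if_neg hi)

theorem norm_prodPow_le_add {σ τ : ℝ} {z : ℂ} (h1 : σ ≤ z.re) (h2 : z.re ≤ τ)
    (x : EuclideanSpace ℝ (Fin n)) :
    ‖prodPow (fun _ => z) x‖ ≤
      ‖prodPow (fun _ => (σ : ℂ)) x‖ + ‖prodPow (fun _ => (τ : ℂ)) x‖ := by
  by_cases hx : ∀ i, 0 < x i
  · have hD : 0 < ∏ i, x i := Finset.prod_pos fun i _ => hx i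
    simp only [prodPow_const_of_pos _ hx, Complex.norm_cpow_eq_rpow_re_of_pos hD,
      Complex.ofReal_re]
    rcases le_total 1 (∏ i, x i) with h | h
    · exact (Real.rpow_le_rpow_of_exponent_le h h2).trans
        (le_add_of_nonneg_left (Real.rpow_nonneg hD.le _))
    · exact (Real.rpow_le_rpow_of_exponent_ge hD h h1).trans
        (le_add_of_nonneg_right (Real.rpow_nonneg hD.le _))
  · simp [prodPow_of_not_pos _ hx]

theorem hasDerivAt_prodPow_const (x : EuclideanSpace ℝ (Fin n)) (s : ℂ) :
    HasDerivAt (fun s => prodPow (fun _ => s) x)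
      (prodPow (fun _ => s) x * Complex.log ((∏ i, x i : ℝ) : ℂ)) s := by
  by_cases hx : ∀ i, 0 < x i
  · have hD : 0 < ∏ i, x i := Finset.prod_pos fun i _ => hx i
    simp only [prodPow_const_of_pos _ hx]
    simpa using (hasDerivAt_id s).const_cpow (c := ((∏ i, x i : ℝ) : ℂ))
      (Or.inl (by exact_mod_cast hD.ne'))
  · simp only [prodPow_of_not_pos _ hx, zero_mul]
    exact hasDerivAt_const _ _

/-- Differentiation under the integral brings in $\log D(x)$. Cauchy's estimate on a circle bounds
it, together with the power, by powers with exponents near $s$. -/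
theorem differentiableAt_pairing {k : ℝ} (hk : 0 ≤ k) (φ : 𝓢(EuclideanSpace ℝ (Fin n), ℂ))
    {s : ℂ} (hs : -1 < s.re) :
    DifferentiableAt ℂ (fun s => pairing φ (fun _ => s) (weight k)) s := by
  -- A point at distance less than `r` and a Cauchy circle of radius `r` about it move the exponent
  -- by at most $2r$, and $\operatorname{Re}s-2r=r-1>-1$.
  set r : ℝ := (s.re + 1) / 3 with hr
  have hr0 : 0 < r := by simp only [hr]; linarith
  have hint : ∀ σ : ℝ, -1 < σ → Integrable fun x =>
      φ x * prodPow (fun _ => (σ : ℂ)) x * (weight k x : ℝ) := fun σ hσ =>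
    integrable_weight hk φ fun _ => by simpa using hσ
  have i1 := hint (s.re - 2 * r) (by linarith)
  have i2 := hint (s.re + 2 * r) (by linarith)
  have hlog : Measurable fun x : EuclideanSpace ℝ (Fin n) =>
      Complex.log ((∏ i, x i : ℝ) : ℂ) := by fun_prop
  refine (hasDerivAt_integral_of_dominated_loc_of_deriv_le
    (F' := fun s x => φ x * (prodPow (fun _ => s) x * Complex.log ((∏ i, x i : ℝ) : ℂ)) *
      (weight k x : ℝ))
    (bound := fun x => (1 / r) * (‖φ x * prodPow (fun _ => ((s.re - 2 * r : ℝ) : ℂ)) x *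
      (weight k x : ℝ)‖ + ‖φ x * prodPow (fun _ => ((s.re + 2 * r : ℝ) : ℂ)) x *
      (weight k x : ℝ)‖)) (Metric.ball_mem_nhds s hr0) ?_ (integrable_weight hk φ fun _ => hs)
    ?_ ?_ ((i1.norm.add i2.norm).const_mul _) ?_).2.differentiableAt
  · exact Eventually.of_forall fun z => ((φ.continuous.measurable.mul (measurable_prodPow _)).mul
      (measurable_weight hk).complex_ofReal).aestronglyMeasurable
  · exact ((φ.continuous.measurable.mul ((measurable_prodPow _).mul hlog)).mul
      (measurable_weight hk).complex_ofReal).aestronglyMeasurable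
  · refine Eventually.of_forall fun x z hz => ?_
    have h1 : ‖prodPow (fun _ => z) x * Complex.log ((∏ i, x i : ℝ) : ℂ)‖ ≤
        (‖prodPow (fun _ => ((s.re - 2 * r : ℝ) : ℂ)) x‖ +
          ‖prodPow (fun _ => ((s.re + 2 * r : ℝ) : ℂ)) x‖) / r := by
      rw [← (hasDerivAt_prodPow_const x z).deriv]
      refine Complex.norm_deriv_le_of_forall_mem_sphere_norm_le hr0 (Differentiable.diffContOnCl
        fun w => (hasDerivAt_prodPow_const x w).differentiableAt) fun w hw => ?_
      have e1 : |z.re - s.re| < r := by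
        rw [← Complex.sub_re]
        exact (Complex.abs_re_le_norm _).trans_lt (by simpa [dist_eq_norm] using hz)
      have e2 : |w.re - z.re| ≤ r := by
        rw [← Complex.sub_re]
        exact (Complex.abs_re_le_norm _).trans_eq (by simpa [dist_eq_norm] using hw)
      rw [abs_lt] at e1
      rw [abs_le] at e2
      exact norm_prodPow_le_add (by linarith) (by linarith) x
    calc _ = ‖φ x‖ * ‖prodPow (fun _ => z) x * Complex.log ((∏ i, x i : ℝ) : ℂ)‖ *
          ‖(weight k x : ℂ)‖ := by rw [norm_mul, norm_mul]
      _ ≤ ‖φ x‖ * ((‖prodPow (fun _ => ((s.re - 2 * r : ℝ) : ℂ)) x‖ +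
          ‖prodPow (fun _ => ((s.re + 2 * r : ℝ) : ℂ)) x‖) / r) * ‖(weight k x : ℂ)‖ := by gcongr
      _ = _ := by simp only [norm_mul]; ring
  · exact Eventually.of_forall fun x z _ =>
      ((hasDerivAt_prodPow_const x z).const_mul (φ x)).mul_const _

/-! ### Riesz distributions and their Gamma factors -/

/-- The tempered distribution `R_μ`, for `Re μ > μ₀`. -/
noncomputable def rieszDist (n : ℕ) (k : ℝ) (μ : ℂ) : 𝓢'(EuclideanSpace ℝ (Fin n), ℂ) :=
  (1 / (dConst n k * multiGamma n k μ)) • prodPowDist k fun _ => μ - muZero n k - 1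

theorem rieszDist_apply {k : ℝ} (hk : 0 ≤ k) {μ : ℂ} (hμ : muZero n k < μ.re)
    (φ : 𝓢(EuclideanSpace ℝ (Fin n), ℂ)) :
    rieszDist n k μ φ = 1 / (dConst n k * multiGamma n k μ) *
      pairing φ (fun _ => μ - muZero n k - 1) (weight k) := by
  rw [← prodPowDist_apply hk (fun _ => by simp; linarith)]
  rfl

theorem measurableSet_posOrthant : MeasurableSet (posOrthant n) := by
  simp only [posOrthant, Set.ofPred_forall]
  exact MeasurableSet.iInter fun i => measurableSet_lt measurable_const (by fun_prop)

theorem isRieszMeasure_rieszDist {k : ℝ} (hk : 0 ≤ k) {μ : ℂ} (hμ : muZero n k < μ.re) :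
    IsRieszMeasure k μ (rieszDist n k μ) := by
  intro φ
  set s := μ - muZero n k - 1 with hs
  set c := 1 / (dConst n k * multiGamma n k μ) with hc
  have hi : Integrable fun x => c * (φ x * prodPow (fun _ => s) x * (weight k x : ℝ)) :=
    (integrable_weight hk φ fun _ => by simp [hs]; linarith).const_mul c
  have he : ∀ x ∈ posOrthant n, c * (φ x * prodPow (fun _ => s) x * (weight k x : ℝ)) =
      φ x * rieszDensity k μ x := fun x hx => by
    rw [rieszDensity, prodPow_const_of_pos _ hx]
    ring
  refine ⟨hi.integrableOn.congr_fun he measurableSet_posOrthant, ?_⟩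
  rw [rieszDist_apply hk hμ, ← setIntegral_congr_fun measurableSet_posOrthant he,
    setIntegral_eq_integral_of_forall_compl_eq_zero (fun x hx => ?_), integral_const_mul]
  · rfl
  · rw [prodPow_of_not_pos _ hx]
    simp

theorem multiGamma_eq (n : ℕ) (k : ℝ) (μ : ℂ) :
    multiGamma n k μ = ∏ i ∈ Finset.range n, Complex.Gamma (μ - k * i) := by
  unfold multiGamma
  induction n with
  | zero => simp
  | succ n ih =>
    rw [Finset.prod_Icc_succ_top (by omega), ih, Finset.prod_range_succ]
    congr 3
    push_cast
    ring

/-- In the form $1/\Gamma(z)=z/\Gamma(z+1)$ the functional equation has no exceptional points. -/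
theorem inv_multiGamma_mul (n : ℕ) (k : ℝ) (μ : ℂ) :
    (multiGamma n k μ)⁻¹ * ∏ i ∈ Finset.range n, (μ - 1 - k * i) =
      (multiGamma n k (μ - 1))⁻¹ := by
  rw [multiGamma_eq, multiGamma_eq, ← Finset.prod_inv_distrib, ← Finset.prod_inv_distrib,
    ← Finset.prod_mul_distrib]
  refine Finset.prod_congr rfl fun i _ => ?_
  rw [Complex.one_div_Gamma_eq_self_mul_one_div_Gamma_add_one (μ - 1 - k * i), mul_comm]
  congr 3
  ring

theorem differentiable_inv_multiGamma (n : ℕ) (k : ℝ) :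
    Differentiable ℂ fun μ => (multiGamma n k μ)⁻¹ := by
  simp_rw [multiGamma_eq, ← Finset.prod_inv_distrib]
  exact Differentiable.fun_finsetProd fun i _ =>
    Complex.differentiable_one_div_Gamma.comp (differentiable_id.sub_const _)

theorem differentiableAt_rieszDist {k : ℝ} (hk : 0 ≤ k) {μ : ℂ} (hμ : muZero n k < μ.re)
    (φ : 𝓢(EuclideanSpace ℝ (Fin n), ℂ)) :
    DifferentiableAt ℂ (fun μ => rieszDist n k μ φ) μ := by
  have h1 : DifferentiableAt ℂ (fun μ => (dConst n k : ℂ)⁻¹ * (multiGamma n k μ)⁻¹ *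
      pairing φ (fun _ => μ - muZero n k - 1) (weight k)) μ :=
    (((differentiable_inv_multiGamma n k) μ).const_mul _).mul
      (DifferentiableAt.comp (g := fun s => pairing φ (fun _ => s) (weight k)) μ
        (differentiableAt_pairing hk φ (s := μ - muZero n k - 1) (by simp; linarith))
        (by fun_prop : DifferentiableAt ℂ (fun μ : ℂ => μ - muZero n k - 1) μ))
  refine h1.congr_of_eventuallyEq ?_
  filter_upwards [(isOpen_lt continuous_const Complex.continuous_re).mem_nhds hμ] with z hz
  rw [rieszDist_apply hk hz, one_div, mul_inv]

theorem dunklProdDist_rieszDist_of_large {k : ℝ} (hk : 0 ≤ k) {μ : ℂ}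
    (hμ : muZero n k + 2 < μ.re) :
    dunklProdDist n k (rieszDist n k μ) = rieszDist n k (μ - 1) := by
  have hs : 1 < (μ - muZero n k - 1 : ℂ).re := by simp; linarith
  rw [rieszDist, map_smul, dunklProdDist_prodPowDist hk hs, smul_smul, rieszDist]
  congr 1
  · rw [one_div, one_div, mul_inv, mul_inv, mul_assoc, ← inv_multiGamma_mul]
    congr 2
    -- For $s=\mu-\mu_0-1$ one has $s+k(n-1-i)=\mu-1-ki$.
    refine Finset.prod_congr rfl fun i _ => ?_
    simp only [muZero]
    push_cast
    ring
  · congr 1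
    ext
    ring

/-! ### Analytic continuation -/

/-- Moving the operators onto a test function independent of `μ` lets holomorphy pass from $u_\mu$
to its image; neither linearity nor continuity of `A` matters for this. -/
theorem exists_adjoint_list_prod :
    ∀ L : List (𝓢'(EuclideanSpace ℝ (Fin n), ℂ) →L[ℂ] 𝓢'(EuclideanSpace ℝ (Fin n), ℂ)),
      (∀ T ∈ L, ∃ A : 𝓢(EuclideanSpace ℝ (Fin n), ℂ) → 𝓢(EuclideanSpace ℝ (Fin n), ℂ),
        ∀ u φ, T u φ = u (A φ)) →
      ∃ A : 𝓢(EuclideanSpace ℝ (Fin n), ℂ) → 𝓢(EuclideanSpace ℝ (Fin n), ℂ),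
        ∀ u φ, L.prod u φ = u (A φ)
  | [], _ => ⟨id, fun _ _ => rfl⟩
  | T :: L, h => by
    obtain ⟨A, hA⟩ := h T List.mem_cons_self
    obtain ⟨B, hB⟩ := exists_adjoint_list_prod L fun T hT => h T (List.mem_cons_of_mem _ hT)
    exact ⟨fun φ => B (A φ), fun u φ => by
      rw [List.prod_cons, mul_apply_eq_comp, hA, hB]⟩

theorem exists_adjoint_dunklProdDist_pow (n : ℕ) (k : ℝ) (m : ℕ) :
    ∃ A : 𝓢(EuclideanSpace ℝ (Fin n), ℂ) → 𝓢(EuclideanSpace ℝ (Fin n), ℂ),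
      ∀ u φ, (dunklProdDist n k ^ m) u φ = u (A φ) := by
  have h1 : ∃ A : 𝓢(EuclideanSpace ℝ (Fin n), ℂ) → 𝓢(EuclideanSpace ℝ (Fin n), ℂ),
      ∀ u φ, dunklProdDist n k u φ = u (A φ) := by
    refine exists_adjoint_list_prod _ fun T hT => ?_
    obtain ⟨i, rfl⟩ := (List.mem_ofFn' _ _).1 hT
    exact ⟨fun φ => -dunklOp k i φ, fun u φ => rfl⟩
  have := exists_adjoint_list_prod (List.replicate m (dunklProdDist n k)) fun T hT => by
    rwa [List.eq_of_mem_replicate hT]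
  rwa [List.prod_replicate] at this

/-- Two functions holomorphic on a right half-plane that agree on a smaller one are equal. -/
theorem eq_of_eq_on_halfPlane {f g : ℂ → ℂ} {σ τ : ℝ}
    (hf : ∀ μ : ℂ, σ < μ.re → DifferentiableAt ℂ f μ)
    (hg : ∀ μ : ℂ, σ < μ.re → DifferentiableAt ℂ g μ)
    (h : ∀ μ : ℂ, τ < μ.re → f μ = g μ) {μ : ℂ} (hμ : σ < μ.re) : f μ = g μ := by
  have ho : ∀ c : ℝ, IsOpen {z : ℂ | c < z.re} := fun c =>
    isOpen_lt continuous_const Complex.continuous_re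
  have hp : IsPreconnected {z : ℂ | σ < z.re} := (convex_halfSpace_re_gt σ).isPreconnected
  have hz : σ < ((max σ τ + 1 : ℝ) : ℂ).re := by
    rw [Complex.ofReal_re]; linarith [le_max_left σ τ]
  have hz' : τ < ((max σ τ + 1 : ℝ) : ℂ).re := by
    rw [Complex.ofReal_re]; linarith [le_max_right σ τ]
  refine AnalyticOnNhd.eqOn_of_preconnected_of_eventuallyEq
    (DifferentiableOn.analyticOnNhd (fun z hz => (hf z hz).differentiableWithinAt) (ho σ))
    (DifferentiableOn.analyticOnNhd (fun z hz => (hg z hz).differentiableWithinAt) (ho σ))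
    hp hz ?_ hμ
  filter_upwards [(ho τ).mem_nhds hz'] with w hw using h w hw

/-- Integration by parts cost one unit of $\operatorname{Re}\mu$. Both sides are holomorphic on the
larger half-plane, so the identity theorem recovers it. -/
theorem dunklProdDist_rieszDist {k : ℝ} (hk : 0 ≤ k) {μ : ℂ} (hμ : muZero n k + 1 < μ.re) :
    dunklProdDist n k (rieszDist n k μ) = rieszDist n k (μ - 1) := by
  ext φ
  obtain ⟨A, hA⟩ := exists_adjoint_dunklProdDist_pow n k 1
  rw [pow_one] at hA
  rw [hA]
  refine eq_of_eq_on_halfPlane (f := fun μ => rieszDist n k μ (A φ))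
    (g := fun μ => rieszDist n k (μ - 1) φ) (τ := muZero n k + 2) (fun z hz => ?_)
    (fun z hz => ?_) (fun z hz => ?_) hμ
  · exact differentiableAt_rieszDist hk (by linarith) _
  · exact (differentiableAt_rieszDist hk (μ := z - 1) (by simp; linarith) φ).comp z
      (by fun_prop : DifferentiableAt ℂ (fun z : ℂ => z - 1) z)
  · rw [← hA, dunklProdDist_rieszDist_of_large hk hz]

theorem pow_rieszDist_eq {k : ℝ} (hk : 0 ≤ k) {μ : ℂ} {m p : ℕ} (hmp : m ≤ p)
    (hm : muZero n k < μ.re + m) :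
    (dunklProdDist n k ^ p) (rieszDist n k (μ + p)) =
      (dunklProdDist n k ^ m) (rieszDist n k (μ + m)) := by
  induction p, hmp using Nat.le_induction with
  | base => rfl
  | succ p hp ih =>
    have h1 : (m : ℝ) ≤ p := by exact_mod_cast hp
    -- One factor is spent on lowering $\mu+p+1$ to $\mu+p$, whose real part still exceeds $\mu_0$.
    rw [← ih, pow_succ, mul_apply_eq_comp,
      dunklProdDist_rieszDist hk (by simp; linarith)]
    congr 2
    push_cast
    ring

/-- The holomorphic extension of `μ ↦ R_μ`, obtained by applying powers of `D(T(k))`. -/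
noncomputable def rieszExt (n : ℕ) (k : ℝ) (μ : ℂ) : 𝓢'(EuclideanSpace ℝ (Fin n), ℂ) :=
  (dunklProdDist n k ^ ⌈muZero n k + 1 - μ.re⌉₊)
    (rieszDist n k (μ + (⌈muZero n k + 1 - μ.re⌉₊ : ℕ)))

/-- The ceiling in the definition jumps with `μ`. Freedom in `m` allows a single exponent near a
given point, whence holomorphy. -/
theorem rieszExt_eq {k : ℝ} (hk : 0 ≤ k) {μ : ℂ} {m : ℕ} (hm : muZero n k < μ.re + m) :
    rieszExt n k μ = (dunklProdDist n k ^ m) (rieszDist n k (μ + m)) := by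
  have h := Nat.le_ceil (muZero n k + 1 - μ.re)
  rcases le_total ⌈muZero n k + 1 - μ.re⌉₊ m with h1 | h1
  · exact (pow_rieszDist_eq hk h1 (by linarith)).symm
  · exact pow_rieszDist_eq hk h1 hm

theorem isRieszExtension_rieszExt {k : ℝ} (hk : 0 ≤ k) :
    IsRieszExtension n k (rieszExt n k) := by
  refine ⟨fun φ μ => ?_, fun μ hμ => ?_⟩
  · obtain ⟨m, hm⟩ := exists_nat_gt (muZero n k - μ.re)
    obtain ⟨A, hA⟩ := exists_adjoint_dunklProdDist_pow n k m
    have h1 : DifferentiableAt ℂ (fun μ => rieszDist n k (μ + m) (A φ)) μ :=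
      DifferentiableAt.comp (g := fun μ => rieszDist n k μ (A φ)) μ
        (differentiableAt_rieszDist hk (μ := μ + m) (by simp; linarith) (A φ)) (by fun_prop : DifferentiableAt ℂ (fun z : ℂ => z + m) μ)
    refine h1.congr_of_eventuallyEq ?_
    filter_upwards [(isOpen_lt continuous_const Complex.continuous_re).mem_nhds
      (show muZero n k - m < μ.re by linarith)] with z hz
    rw [rieszExt_eq hk (m := m) (by linarith [show muZero n k - m < z.re from hz]), hA]
  · rw [rieszExt_eq hk (m := 0) (by simpa using hμ)]
    simpa using isRieszMeasure_rieszDist hk hμ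

theorem dunklProdDist_rieszExt {k : ℝ} (hk : 0 ≤ k) (μ : ℂ) :
    dunklProdDist n k (rieszExt n k μ) = rieszExt n k (μ - 1) := by
  obtain ⟨m, hm⟩ := exists_nat_gt (muZero n k - μ.re)
  -- Exponents `m` at $\mu$ and `m + 1` at $\mu-1$ rest on the same $R_{\mu+m}$.
  rw [rieszExt_eq hk (m := m) (by linarith),
    rieszExt_eq hk (μ := μ - 1) (m := m + 1) (by simp; linarith), pow_succ', mul_apply_eq_comp]
  congr 3
  push_cast
  ring

theorem IsRieszExtension.unique {k : ℝ} {R R' : ℂ → 𝓢'(EuclideanSpace ℝ (Fin n), ℂ)}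
    (h : IsRieszExtension n k R) (h' : IsRieszExtension n k R') : R' = R := by
  ext μ φ
  -- Both functions are entire, so any half-plane containing `μ` will do.
  exact eq_of_eq_on_halfPlane (f := fun μ => R' μ φ) (g := fun μ => R μ φ) (σ := μ.re - 1)
    (τ := muZero n k) (fun z _ => h'.1 φ z) (fun z _ => h.1 φ z)
    (fun z hz => (h'.2 z hz φ).2.trans (h.2 z hz φ).2.symm) (by linarith)

end TypeADunkl

theorem mainTheorem7 (n : ℕ) (hn : 1 ≤ n) (k : ℝ) (hk : 0 ≤ k) :
    ∃ R : ℂ → 𝓢'(EuclideanSpace ℝ (Fin n), ℂ),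
      TypeADunkl.IsRieszExtension n k R ∧
      (∀ R' : ℂ → 𝓢'(EuclideanSpace ℝ (Fin n), ℂ),
        TypeADunkl.IsRieszExtension n k R' → R' = R) ∧
      ∀ μ : ℂ, TypeADunkl.dunklProdDist n k (R μ) = R (μ - 1) :=
  ⟨TypeADunkl.rieszExt n k, TypeADunkl.isRieszExtension_rieszExt hk,
    fun _ h => (TypeADunkl.isRieszExtension_rieszExt hk).unique h,
    TypeADunkl.dunklProdDist_rieszExt hk⟩
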